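/- \textbf{Setting.} Let $\mathbf C$ be a compact dagger category: a symmetric monoidal category with an involutive identity-on-objects contravariant functor $\dagger$ that preserves $\otimes$, with unitary coherence isomorphisms, in which every object $X$ has a dual $X^*$ with cup $\eta_X\colon I\to X^*\otimes X$ and cap $\varepsilon_X\colon X\otimes X^*\to I$ satisfying the snake equations and $\varepsilon_X^\dagger=\sigma_{X^*,X}\circ\eta_X$, where $\sigma$ is the symmetry. A dagger Frobenius structure is a monoid $(A,m,u)$ with $(m\otimes 1)(1\otimes m^\dagger)=(1\otimes m)(m^\dagger\otimes 1)$; it is special if $m m^\dagger=1$, symmetric if $u^\dagger m\sigma=u^\dagger m$. A classical structure is a special commutative dagger Frobenius structure; a state $s\colon I\to A$ is copyable if $m^\dagger s=s\otimes s$. The category $\mathrm{CP}^*[\mathbf C]$ has as objects the special symmetric dagger Frobenius structures in $\mathbf C$; its morphisms $A\to B$ are the morphisms $f\colon A\to B$ of $\mathbf C$ such that $a_B\circ f\circ a_A^\dagger=(1_{B^*}\otimes\mathrm{cap}_Z\otimes 1_B)\circ(g_*\otimes g)$ for some object $Z$ and some $g\colon A\to Z\otimes B$, where $a_A=(1_{A^*}\otimes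 m)(\eta_A\otimes 1_A)\colon A\to A^*\otimes A$, $g_*\colon A^*\to B^*\otimes Z^*$ is the conjugate of $g$, and $\mathrm{cap}_Z=\eta_Z^\dagger\colon Z^*\otimes Z\to I$. Its tensor product is inherited from $\mathbf C$. Write $e_A=u^\dagger$ for discarding $A$. An object $A$ of $\mathrm{CP}^*[\mathbf C]$ is \emph{broadcastable} if there is $b\colon A\to A\otimes A$ in $\mathrm{CP}^*[\mathbf C]$ with $(e_A\otimes 1)b=1_A=(1\otimes e_A)b$. It \emph{admits entanglement} if for some object $B$ there is a state $I\to A\otimes B$ of $\mathrm{CP}^*[\mathbf C]$ that is not of the form $(f\otimes g)\circ\psi$ with $\psi\colon I\to A'\otimes B'$, $f\colon A'\to A$, $g\colon B'\to B$ in $\mathrm{CP}^*[\mathbf C]$ and $A',B'$ broadcastable. Call $\mathbf C$ \emph{nonlocal} if $\mathrm{CP}^*[\mathbf C]$ has an object that is not broadcastable and every such object admits entanglement. A \emph{bit commitment protocol} on $\mathbf C$ consists of states $H,T\colon I\to A\otimes B$ of $\mathrm{CP}^*[\mathbf C]$, a monomorphism $\mathrm{unveil}\colon A\otimes B\to A\otimes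 B$ of $\mathrm{CP}^*[\mathbf C]$, and a classical structure in $\mathbf C$ on the object $A\otimes B$ with copyable states $\widehat H\neq\widehat T$. It is \emph{secure} if it is sound ($\mathrm{unveil}\circ H=\widehat H$ and $\mathrm{unveil}\circ T=\widehat T$), concealing ($(e_A\otimes 1_B)H=(e_A\otimes 1_B)T$) and binding ($(v\otimes 1_B)H\neq T$ for all $v\colon A\to A$ in $\mathrm{CP}^*[\mathbf C]$). \textbf{Theorem.} For general compact dagger categories $\mathbf C$, neither of ``$\mathbf C$ has no secure bit commitment protocol'' and ``$\mathbf C$ is nonlocal'' implies the other. More precisely: \begin{enumerate} \item The category $\mathbf{Rel}$ of sets and relations is nonlocal and has a secure bit commitment protocol. \item There is a compact dagger category, having an object with two distinct states $I\to X$, that has no secure bit commitment protocol and in which no object of $\mathrm{CP}^*[\mathbf C]$ admits entanglement; in particular it is not nonlocal. \item In the category $\mathbf{Rel}(\mathbf{Gp})$, whose objects are groups and whose morphisms $G\to H$ are the subgroups of $G\times H$, composed as relations, every classical structure has at most one copyable state; hence $\mathbf{Rel}(\mathbf{Gp})$ has no secure bit commitment protocol. It is nonlocal. \end{enumerate} 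-/

import Mathlib

open CategoryTheory MonoidalCategory MonObj

universe v u

/-! ### Compact dagger categories -/

/-- A compact dagger category: a symmetric monoidal category with an identity-on-objects
involutive contravariant functor `dag` compatible with `⊗`, unitary coherence isomorphisms, and a
dual `dual X` for every object with cup `coev X : I ⟶ X* ⊗ X` and cap `ev X : X ⊗ X* ⟶ I`. -/
class CompactDagger (C : Type u) [Category.{v} C] [MonoidalCategory C] [SymmetricCategory C] where
  dag : ∀ {X Y : C}, (X ⟶ Y) → (Y ⟶ X)
  dag_dag : ∀ {X Y : C} (f : X ⟶ Y), dag (dag f) = f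
  dag_id : ∀ X : C, dag (𝟙 X) = 𝟙 X
  dag_comp : ∀ {X Y Z : C} (f : X ⟶ Y) (g : Y ⟶ Z), dag (f ≫ g) = dag g ≫ dag f
  dag_tensor : ∀ {X X' Y Y' : C} (f : X ⟶ Y) (g : X' ⟶ Y'), dag (f ⊗ₘ g) = dag f ⊗ₘ dag g
  dag_associator : ∀ X Y Z : C, dag (α_ X Y Z).hom = (α_ X Y Z).inv
  dag_leftUnitor : ∀ X : C, dag (λ_ X).hom = (λ_ X).inv
  dag_rightUnitor : ∀ X : C, dag (ρ_ X).hom = (ρ_ X).inv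
  dag_braiding : ∀ X Y : C, dag (β_ X Y).hom = (β_ X Y).inv
  dual : C → C
  coev : ∀ X : C, 𝟙_ C ⟶ dual X ⊗ X
  ev : ∀ X : C, X ⊗ dual X ⟶ 𝟙_ C
  snake : ∀ X : C,
    (ρ_ X).inv ≫ X ◁ coev X ≫ (α_ X (dual X) X).inv ≫ ev X ▷ X ≫ (λ_ X).hom = 𝟙 X
  snake_dual : ∀ X : C,
    (λ_ (dual X)).inv ≫ coev X ▷ dual X ≫ (α_ (dual X) X (dual X)).hom ≫ dual X ◁ ev X ≫
      (ρ_ (dual X)).hom = 𝟙 (dual X)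
  dag_ev : ∀ X : C, dag (ev X) = coev X ≫ (β_ (dual X) X).hom

namespace CompactDagger

variable {C : Type u} [Category.{v} C] [MonoidalCategory C] [SymmetricCategory C] [CompactDagger C]

/-! ### Dagger Frobenius structures -/

/-- Comultiplication: the dagger of the multiplication. -/
def comul (X : C) [MonObj X] : X ⟶ X ⊗ X := dag (μ : X ⊗ X ⟶ X)

/-- Counit (discarding): the dagger of the unit. -/
def counit (X : C) [MonObj X] : X ⟶ 𝟙_ C := dag (η : 𝟙_ C ⟶ X)

/-- A monoid is a special symmetric dagger Frobenius structure. -/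
structure IsSpecialSymmetricFrobenius (X : C) [MonObj X] : Prop where
  frobenius : X ◁ comul X ≫ (α_ X X X).inv ≫ μ ▷ X = comul X ▷ X ≫ (α_ X X X).hom ≫ X ◁ μ
  symmetric : (β_ X X).hom ≫ μ ≫ counit X = μ ≫ counit X
  special : comul X ≫ μ = 𝟙 X

/-- A monoid is a classical structure: a special commutative dagger Frobenius structure. -/
structure IsClassicalStructure (X : C) [MonObj X] : Prop where
  frobenius : X ◁ comul X ≫ (α_ X X X).inv ≫ μ ▷ X = comul X ▷ X ≫ (α_ X X X).hom ≫ X ◁ μ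
  commutative : (β_ X X).hom ≫ μ = (μ : X ⊗ X ⟶ X)
  special : comul X ≫ μ = 𝟙 X

/-- A state that is copied by the comultiplication. -/
def IsCopyable (X : C) [MonObj X] (s : 𝟙_ C ⟶ X) : Prop :=
  s ≫ comul X = (λ_ (𝟙_ C)).inv ≫ (s ⊗ₘ s)

/-! ### The CP* construction -/

/-- The action `X ⟶ X* ⊗ X` of a monoid on itself. -/
def action (X : C) [MonObj X] : X ⟶ dual X ⊗ X :=
  (λ_ X).inv ≫ coev X ▷ X ≫ (α_ (dual X) X X).hom ≫ dual X ◁ μ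

/-- The coaction `X* ⊗ X ⟶ X`. -/
def coaction (X : C) [MonObj X] : dual X ⊗ X ⟶ X := dag (action X)

/-- The conjugate of `g : X ⟶ Z ⊗ Y`, with its `Z`-wire bent round to become an input. -/
def bentConj {X Y Z : C} (g : X ⟶ Z ⊗ Y) : dual X ⊗ Z ⟶ dual Y :=
  (ρ_ (dual X ⊗ Z)).inv ≫ (dual X ⊗ Z) ◁ dag (ev Y) ≫
    (α_ (dual X ⊗ Z) Y (dual Y)).inv ≫ (α_ (dual X) Z Y).hom ▷ dual Y ≫
      (dual X ◁ dag g) ▷ dual Y ≫ dag (coev X) ▷ dual Y ≫ (λ_ (dual Y)).hom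

/-- The doubling `X* ⊗ X ⟶ Y* ⊗ Y` of `g : X ⟶ Z ⊗ Y`: the tensor product of the conjugate of `g`
and `g`, with the two `Z`-wires joined by a cap. -/
def doubling {X Y Z : C} (g : X ⟶ Z ⊗ Y) : dual X ⊗ X ⟶ dual Y ⊗ Y :=
  dual X ◁ g ≫ (α_ (dual X) Z Y).inv ≫ bentConj g ▷ Y

/-- The CP*-condition on a morphism between the carriers of two dagger Frobenius structures. -/
def IsCP {X Y : C} [MonObj X] [MonObj Y] (f : X ⟶ Y) : Prop :=
  ∃ (Z : C) (g : X ⟶ Z ⊗ Y), coaction X ≫ f ≫ action Y = doubling g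

variable (C) in
/-- The objects of `CP*[C]`. Morphisms `A ⟶ B` of `CP*[C]` are the morphisms `f : A.X ⟶ B.X` of `C`
with `IsCP f`, composed as in `C`; the tensor product of `A` and `B` is the product monoid
on `A.X ⊗ B.X`, and the tensor unit is the trivial monoid on `𝟙_ C`. -/
structure CPStar where
  X : C
  [mon : MonObj X]
  frob : IsSpecialSymmetricFrobenius X

attribute [instance] CPStar.mon

/-! ### Broadcasting, bit commitment, nonlocality -/

/-- `A` is broadcastable: there is a broadcasting map `A ⟶ A ⊗ A` in `CP*[C]`. -/
def IsBroadcastable (A : CPStar C) : Prop :=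
  ∃ b : A.X ⟶ A.X ⊗ A.X, IsCP b ∧
    b ≫ counit A.X ▷ A.X ≫ (λ_ A.X).hom = 𝟙 A.X ∧
    b ≫ A.X ◁ counit A.X ≫ (ρ_ A.X).hom = 𝟙 A.X

/-- `f` is a monomorphism of `CP*[C]` (for `f` satisfying the CP*-condition). -/
def IsCPMono {X Y : C} [MonObj X] [MonObj Y] (f : X ⟶ Y) : Prop :=
  ∀ (W : CPStar C) (h k : W.X ⟶ X), IsCP h → IsCP k → h ≫ f = k ≫ f → h = k

variable (C) in
/-- A bit commitment protocol. The classical structure on the object `A ⊗ B` of `C`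
is independent of the structure that `A ⊗ B` carries as an object of `CP*[C]`. -/
structure BitCommitment where
  A : CPStar C
  B : CPStar C
  H : 𝟙_ C ⟶ A.X ⊗ B.X
  T : 𝟙_ C ⟶ A.X ⊗ B.X
  isCP_H : IsCP H
  isCP_T : IsCP T
  unveil : A.X ⊗ B.X ⟶ A.X ⊗ B.X
  isCP_unveil : IsCP unveil
  mono_unveil : IsCPMono unveil
  cl : MonObj (A.X ⊗ B.X)
  isClassical : @IsClassicalStructure C _ _ _ _ (A.X ⊗ B.X) cl
  Hhat : 𝟙_ C ⟶ A.X ⊗ B.X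
  That : 𝟙_ C ⟶ A.X ⊗ B.X
  copyable_Hhat : @IsCopyable C _ _ _ _ (A.X ⊗ B.X) cl Hhat
  copyable_That : @IsCopyable C _ _ _ _ (A.X ⊗ B.X) cl That
  Hhat_ne_That : Hhat ≠ That

namespace BitCommitment

/-- Unveiling turns `H`, `T` into the perfectly distinguishable states `Hhat`, `That`. -/
def Sound (P : BitCommitment C) : Prop :=
  P.H ≫ P.unveil = P.Hhat ∧ P.T ≫ P.unveil = P.That

/-- After discarding the first system, `H` and `T` are equal. -/
def Concealing (P : BitCommitment C) : Prop :=
  P.H ≫ counit P.A.X ▷ P.B.X = P.T ≫ counit P.A.X ▷ P.B.X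

/-- No local operation on the first system turns `H` into `T`. -/
def Binding (P : BitCommitment C) : Prop :=
  ∀ u : P.A.X ⟶ P.A.X, IsCP u → P.H ≫ u ▷ P.B.X ≠ P.T

/-- Sound, concealing and binding. -/
def Secure (P : BitCommitment C) : Prop :=
  P.Sound ∧ P.Concealing ∧ P.Binding

end BitCommitment

variable (C) in
/-- Secure bit commitment is possible. -/
def SupportsBitCommitment : Prop := ∃ P : BitCommitment C, P.Secure

/-- Some state of `A ⊗ B` in `CP*[C]`, for some `B`, is not of the form `(f ⊗ g) ∘ ψ` with
`ψ` a state of `A' ⊗ B'` for broadcastable `A'` and `B'`. -/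
def AdmitsEntanglement (A : CPStar C) : Prop :=
  ∃ (B : CPStar C) (ω : 𝟙_ C ⟶ A.X ⊗ B.X), IsCP ω ∧
    ¬ ∃ (A' B' : CPStar C) (ψ : 𝟙_ C ⟶ A'.X ⊗ B'.X) (f : A'.X ⟶ A.X) (g : B'.X ⟶ B.X),
      IsBroadcastable A' ∧ IsBroadcastable B' ∧ IsCP ψ ∧ IsCP f ∧ IsCP g ∧ ω = ψ ≫ (f ⊗ₘ g)

variable (C) in
/-- There are objects of `CP*[C]` that are not broadcastable, and all of these admit
entanglement. (A broadcastable object, such as the tensor unit, never admits entanglement.) -/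
def Nonlocal : Prop :=
  (∃ A : CPStar C, ¬ IsBroadcastable A) ∧
    ∀ A : CPStar C, ¬ IsBroadcastable A → AdmitsEntanglement A

end CompactDagger

/-! ### Sets and relations -/

/-- The objects of `Rel`: sets. -/
structure RelSet : Type (u + 1) where
  of ::
  carrier : Type u

namespace RelSet

instance : CoeSort RelSet.{u} (Type u) := ⟨carrier⟩

/-- The morphisms of `Rel`: binary relations. -/
@[ext]
structure Hom (X Y : RelSet.{u}) : Type u where
  R : X → Y → Prop

/-- Composition of relations. -/
instance : LargeCategory RelSet.{u} where
  Hom := Hom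
  id _ := ⟨fun x y => x = y⟩
  comp f g := ⟨fun x z => ∃ y, f.R x y ∧ g.R y z⟩

@[ext] theorem hom_ext {X Y : RelSet.{u}} {f g : X ⟶ Y} (h : ∀ x y, f.R x y ↔ g.R x y) : f = g :=
  Hom.ext (funext fun x => funext fun y => propext (h x y))

@[simp] theorem R_id {X : RelSet.{u}} (x y : X) : Hom.R (𝟙 X) x y ↔ x = y := Iff.rfl

@[simp] theorem R_comp {X Y Z : RelSet.{u}} (f : X ⟶ Y) (g : Y ⟶ Z) (x : X) (z : Z) :
    Hom.R (f ≫ g) x z ↔ ∃ y, f.R x y ∧ g.R y z := Iff.rfl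

/-- The isomorphism given by the graph of a bijection. -/
def isoMk {X Y : RelSet.{u}} (e : X ≃ Y) : X ≅ Y where
  hom := Hom.mk fun x y => e x = y
  inv := Hom.mk fun y x => e x = y
  hom_inv_id := by ext x y; simp [eq_comm]
  inv_hom_id := by
    ext x y
    exact ⟨fun ⟨z, h, h'⟩ => h.symm.trans h', fun h => ⟨e.symm x, by simp, by simpa using h⟩⟩

@[simp] theorem R_isoMk_hom {X Y : RelSet.{u}} (e : X ≃ Y) (x : X) (y : Y) :
    Hom.R (isoMk e).hom x y ↔ e x = y := Iff.rfl

@[simp] theorem R_isoMk_inv {X Y : RelSet.{u}} (e : X ≃ Y) (x : X) (y : Y) :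
    Hom.R (isoMk e).inv y x ↔ e x = y := Iff.rfl

/-- The cartesian product of sets, acting on relations componentwise. -/
instance : MonoidalCategoryStruct RelSet.{u} where
  tensorObj X Y := of (X × Y)
  whiskerLeft _ _ _ f := Hom.mk fun p q => p.1 = q.1 ∧ f.R p.2 q.2
  whiskerRight f _ := Hom.mk fun p q => f.R p.1 q.1 ∧ p.2 = q.2
  tensorHom f g := Hom.mk fun p q => f.R p.1 q.1 ∧ g.R p.2 q.2
  tensorUnit := of PUnit
  associator X Y Z := isoMk (Equiv.prodAssoc X Y Z)
  leftUnitor X := isoMk (Equiv.punitProd X)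
  rightUnitor X := isoMk (Equiv.prodPUnit X)

section

variable {X X' Y Y' Z : RelSet.{u}}

@[simp] theorem R_whiskerLeft (f : Y ⟶ Y') (p : (X ⊗ Y : RelSet)) (q : (X ⊗ Y' : RelSet)) :
    Hom.R (X ◁ f) p q ↔ p.1 = q.1 ∧ f.R p.2 q.2 := Iff.rfl

@[simp] theorem R_whiskerRight (f : X ⟶ X') (p : (X ⊗ Y : RelSet)) (q : (X' ⊗ Y : RelSet)) :
    Hom.R (f ▷ Y) p q ↔ f.R p.1 q.1 ∧ p.2 = q.2 := Iff.rfl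

@[simp] theorem R_tensorHom (f : X ⟶ X') (g : Y ⟶ Y') (p : (X ⊗ Y : RelSet))
    (q : (X' ⊗ Y' : RelSet)) : Hom.R (f ⊗ₘ g) p q ↔ f.R p.1 q.1 ∧ g.R p.2 q.2 := Iff.rfl

theorem associator_def : α_ X Y Z = isoMk (Equiv.prodAssoc X Y Z) := rfl

theorem leftUnitor_def : λ_ X = isoMk (Equiv.punitProd X) := rfl

theorem rightUnitor_def : ρ_ X = isoMk (Equiv.prodPUnit X) := rfl

end

instance : MonoidalCategory RelSet.{u} where
  tensorHom_def f g := by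
    ext ⟨a, b⟩ ⟨c, d⟩
    exact ⟨fun ⟨h, h'⟩ => ⟨(c, b), ⟨h, rfl⟩, rfl, h'⟩, by
      rintro ⟨⟨e, e'⟩, ⟨h, h1⟩, h2, h3⟩
      dsimp only at h h1 h2 h3
      subst h1 h2
      exact ⟨h, h3⟩⟩
  id_tensorHom_id X Y := by
    ext ⟨a, b⟩ ⟨c, d⟩
    exact Prod.mk_inj.symm
  tensorHom_comp_tensorHom f f' g g' := by
    ext ⟨a, b⟩ ⟨c, d⟩
    exact ⟨fun ⟨p, h, h'⟩ => ⟨⟨p.1, h.1, h'.1⟩, ⟨p.2, h.2, h'.2⟩⟩,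
      fun ⟨⟨p, h⟩, ⟨q, h'⟩⟩ => ⟨(p, q), ⟨h.1, h'.1⟩, ⟨h.2, h'.2⟩⟩⟩
  whiskerLeft_id X Y := by
    ext ⟨a, b⟩ ⟨c, d⟩
    exact Prod.mk_inj.symm
  id_whiskerRight X Y := by
    ext ⟨a, b⟩ ⟨c, d⟩
    exact Prod.mk_inj.symm
  associator_naturality f g h := by
    ext ⟨⟨a, b⟩, c⟩ ⟨a', b', c'⟩
    constructor
    · rintro ⟨⟨⟨x, y⟩, z⟩, ⟨⟨h1, h2⟩, h3⟩, h4⟩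
      cases h4
      exact ⟨(a, b, c), rfl, h1, h2, h3⟩
    · rintro ⟨⟨x, y, z⟩, h4, h1, h2, h3⟩
      cases h4
      exact ⟨((a', b'), c'), ⟨⟨h1, h2⟩, h3⟩, rfl⟩
  leftUnitor_naturality f := by
    ext ⟨⟨⟩, a⟩ b
    constructor
    · rintro ⟨⟨⟨⟩, x⟩, ⟨-, h⟩, h'⟩
      cases h'
      exact ⟨a, rfl, h⟩
    · rintro ⟨x, h', h⟩
      cases h'
      exact ⟨(PUnit.unit, b), ⟨rfl, h⟩, rfl⟩
  rightUnitor_naturality f := by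
    ext ⟨a, ⟨⟩⟩ b
    constructor
    · rintro ⟨⟨x, ⟨⟩⟩, ⟨h, -⟩, h'⟩
      cases h'
      exact ⟨a, rfl, h⟩
    · rintro ⟨x, h', h⟩
      cases h'
      exact ⟨(b, PUnit.unit), ⟨h, rfl⟩, rfl⟩
  pentagon W X Y Z := by
    ext ⟨⟨⟨a, b⟩, c⟩, d⟩ q
    constructor
    · rintro ⟨⟨⟨_, _⟩, _⟩, ⟨h1, h2⟩, ⟨_, _⟩, h3, h4, h5⟩
      cases h1
      cases h2
      cases h3
      obtain ⟨q1, q2⟩ := q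
      cases h4
      cases h5
      exact ⟨((a, b), c, d), rfl, rfl⟩
    · rintro ⟨p, h1, h2⟩
      cases h1
      cases h2
      exact ⟨((a, b, c), d), ⟨rfl, rfl⟩, (a, (b, c), d), rfl, rfl, rfl⟩
  triangle X Y := by
    ext ⟨⟨a, ⟨⟩⟩, b⟩ ⟨c, d⟩
    constructor
    · rintro ⟨p, h1, h2, h3⟩
      cases h1
      cases h2
      cases h3
      exact ⟨rfl, rfl⟩
    · rintro ⟨h1, h2⟩
      cases h1
      cases h2
      exact ⟨(a, PUnit.unit, b), rfl, rfl, rfl⟩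

instance : SymmetricCategory RelSet.{u} where
  braiding X Y := isoMk (Equiv.prodComm X Y)
  braiding_naturality_right X _ _ f := by
    ext ⟨a, b⟩ ⟨c, d⟩
    constructor
    · rintro ⟨⟨_, _⟩, ⟨h1, h2⟩, h3⟩
      cases h1
      cases h3
      exact ⟨(b, a), rfl, h2, rfl⟩
    · rintro ⟨⟨_, _⟩, h3, h1, h2⟩
      cases h2
      cases h3
      exact ⟨(a, c), ⟨rfl, h1⟩, rfl⟩
  braiding_naturality_left f Z := by
    ext ⟨a, b⟩ ⟨c, d⟩
    constructor
    · rintro ⟨⟨_, _⟩, ⟨h1, h2⟩, h3⟩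
      cases h2
      cases h3
      exact ⟨(b, a), rfl, rfl, h1⟩
    · rintro ⟨⟨_, _⟩, h3, h1, h2⟩
      cases h1
      cases h3
      exact ⟨(d, b), ⟨h2, rfl⟩, rfl⟩
  hexagon_forward X Y Z := by
    ext ⟨⟨a, b⟩, c⟩ q
    constructor
    · rintro ⟨_, h1, _, h2, h3⟩
      cases h1
      cases h2
      cases h3
      exact ⟨((b, a), c), ⟨rfl, rfl⟩, (b, a, c), rfl, rfl, rfl⟩
    · rintro ⟨⟨⟨_, _⟩, _⟩, ⟨h1, h1'⟩, ⟨_, _⟩, h2, h3, h4⟩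
      obtain ⟨q1, q2⟩ := q
      cases h1
      cases h1'
      cases h2
      cases h3
      cases h4
      exact ⟨_, rfl, _, rfl, rfl⟩
  hexagon_reverse X Y Z := by
    ext ⟨a, b, c⟩ ⟨⟨d, e⟩, f⟩
    constructor
    · rintro ⟨⟨⟨x, y⟩, z⟩, h1, ⟨x', y', z'⟩, h2, h3⟩
      cases h1
      cases h2
      cases h3
      exact ⟨(e, d, f), ⟨rfl, rfl⟩, ((e, d), f), rfl, rfl, rfl⟩
    · rintro ⟨⟨x, y, z⟩, ⟨h1, h1'⟩, ⟨⟨x', y'⟩, z'⟩, h2, h3, h4⟩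
      cases h1
      cases h1'
      cases h2
      cases h3
      cases h4
      exact ⟨((x', b), c), rfl, (c, x', b), rfl, rfl⟩
  symmetry X Y := by
    ext ⟨a, b⟩ ⟨c, d⟩
    constructor
    · rintro ⟨⟨_, _⟩, h1, h2⟩
      cases h1
      cases h2
      rfl
    · intro h
      cases h
      exact ⟨(b, a), rfl, rfl⟩

/-- The dagger is the converse relation; every set is its own dual, with the diagonal as cup
and cap. -/
instance : CompactDagger RelSet.{u} where
  dag f := Hom.mk fun y x => f.R x y
  dag_dag _ := rfl
  dag_id X := by
    ext x y
    exact eq_comm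
  dag_comp f g := by
    ext x y
    exact ⟨fun ⟨z, h, h'⟩ => ⟨z, h', h⟩, fun ⟨z, h, h'⟩ => ⟨z, h', h⟩⟩
  dag_tensor _ _ := rfl
  dag_associator _ _ _ := rfl
  dag_leftUnitor _ := rfl
  dag_rightUnitor _ := rfl
  dag_braiding _ _ := rfl
  dual X := X
  coev _ := Hom.mk fun _ p => p.1 = p.2
  ev _ := Hom.mk fun p _ => p.1 = p.2
  snake X := by
    ext x y
    constructor
    · rintro ⟨⟨_, _⟩, h1, ⟨_, _, _⟩, ⟨h2, h2'⟩, ⟨⟨_, _⟩, _⟩, h3, ⟨_, _⟩, ⟨h4, h4'⟩, h5⟩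
      cases h1
      cases h2
      cases h2'
      cases h3
      cases h4
      cases h4'
      cases h5
      rfl
    · intro h
      cases h
      exact ⟨(x, PUnit.unit), rfl, (x, x, x), ⟨rfl, rfl⟩, ((x, x), x), rfl, (PUnit.unit, x),
        ⟨rfl, rfl⟩, rfl⟩
  snake_dual X := by
    ext x y
    constructor
    · rintro ⟨⟨_, _⟩, h1, ⟨⟨_, _⟩, _⟩, ⟨h2, h2'⟩, ⟨_, _, _⟩, h3, ⟨_, _⟩, ⟨h4, h4'⟩, h5⟩
      cases h1
      cases h2
      cases h2'
      cases h3
      cases h4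
      cases h4'
      cases h5
      rfl
    · intro h
      cases h
      exact ⟨(PUnit.unit, x), rfl, ((x, x), x), ⟨rfl, rfl⟩, (x, x, x), rfl, (x, PUnit.unit),
        ⟨rfl, rfl⟩, rfl⟩
  dag_ev X := by
    ext p ⟨x, y⟩
    constructor
    · intro h
      exact ⟨(y, x), h.symm, rfl⟩
    · rintro ⟨⟨_, _⟩, h1, h2⟩
      cases h1
      cases h2
      rfl

end RelSet

/-! ### Groups and relations -/

/-- The objects of `Rel(Gp)`: groups. -/
structure RelGrp : Type (u + 1) where
  of ::
  carrier : Type u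
  [group : Group carrier]

namespace RelGrp

instance : CoeSort RelGrp.{u} (Type u) := ⟨carrier⟩

instance (X : RelGrp.{u}) : Group X := X.group

/-- The morphisms of `Rel(Gp)`: internal relations in the category of groups, that is, subobjects
of the product group. -/
@[ext]
structure Hom (X Y : RelGrp.{u}) : Type u where
  sub : Subgroup (X × Y)

/-- The underlying set of a group. -/
def toRelSet (X : RelGrp.{u}) : RelSet.{u} := .of X

/-- The underlying binary relation of a relation of groups. -/
def Hom.toRel {X Y : RelGrp.{u}} (f : Hom X Y) : X.toRelSet ⟶ Y.toRelSet :=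
  RelSet.Hom.mk fun x y => (x, y) ∈ f.sub

theorem Hom.toRel_injective {X Y : RelGrp.{u}} {f g : Hom X Y} (h : f.toRel = g.toRel) : f = g :=
  Hom.ext (Subgroup.ext fun p => iff_of_eq
    (congrFun (congrFun (congrArg RelSet.Hom.R h) p.1) p.2))

/-- Composition of relations. -/
instance : LargeCategory RelGrp.{u} where
  Hom := Hom
  id _ := Hom.mk
    { carrier := {p | p.1 = p.2}
      mul_mem' := fun {_ _} ha hb => congrArg₂ (· * ·) ha hb
      one_mem' := rfl
      inv_mem' := fun {_} ha => congrArg (·⁻¹) ha }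
  comp f g := Hom.mk
    { carrier := {p | ∃ y, (p.1, y) ∈ f.sub ∧ (y, p.2) ∈ g.sub}
      mul_mem' := fun {_ _} ⟨y, h1, h2⟩ ⟨z, h3, h4⟩ =>
        ⟨y * z, f.sub.mul_mem h1 h3, g.sub.mul_mem h2 h4⟩
      one_mem' := ⟨1, f.sub.one_mem, g.sub.one_mem⟩
      inv_mem' := fun {_} ⟨y, h1, h2⟩ => ⟨y⁻¹, f.sub.inv_mem h1, g.sub.inv_mem h2⟩ }
  id_comp f := Hom.toRel_injective (Category.id_comp f.toRel)
  comp_id f := Hom.toRel_injective (Category.comp_id f.toRel)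
  assoc f g h := Hom.toRel_injective (Category.assoc f.toRel g.toRel h.toRel)

/-- The isomorphism given by the graph of a group isomorphism. -/
def isoMk {X Y : RelGrp.{u}} (e : X ≃* Y) : X ≅ Y where
  hom := Hom.mk
    { carrier := {p | e p.1 = p.2}
      mul_mem' := fun {a b} ha hb => (map_mul e a.1 b.1).trans (congrArg₂ (· * ·) ha hb)
      one_mem' := map_one e
      inv_mem' := fun {a} ha => (map_inv e a.1).trans (congrArg (·⁻¹) ha) }
  inv := Hom.mk
    { carrier := {p | e p.2 = p.1}
      mul_mem' := fun {a b} ha hb => (map_mul e a.2 b.2).trans (congrArg₂ (· * ·) ha hb)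
      one_mem' := map_one e
      inv_mem' := fun {a} ha => (map_inv e a.2).trans (congrArg (·⁻¹) ha) }
  hom_inv_id := Hom.toRel_injective
    (RelSet.isoMk (X := X.toRelSet) (Y := Y.toRelSet) e.toEquiv).hom_inv_id
  inv_hom_id := Hom.toRel_injective
    (RelSet.isoMk (X := X.toRelSet) (Y := Y.toRelSet) e.toEquiv).inv_hom_id

/-- The product of two relations of groups. -/
def Hom.prod {X X' Y Y' : RelGrp.{u}} (f : Hom X Y) (g : Hom X' Y') :
    Hom (of (X × X')) (of (Y × Y')) := Hom.mk
  { carrier := {p | (p.1.1, p.2.1) ∈ f.sub ∧ (p.1.2, p.2.2) ∈ g.sub}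
    mul_mem' := fun {_ _} h h' => ⟨f.sub.mul_mem h.1 h'.1, g.sub.mul_mem h.2 h'.2⟩
    one_mem' := ⟨f.sub.one_mem, g.sub.one_mem⟩
    inv_mem' := fun {_} h => ⟨f.sub.inv_mem h.1, g.sub.inv_mem h.2⟩ }

/-- The product of groups, acting on relations componentwise. -/
instance : MonoidalCategoryStruct RelGrp.{u} where
  tensorObj X Y := of (X × Y)
  whiskerLeft X _ _ f := Hom.prod (𝟙 X) f
  whiskerRight f Y := Hom.prod f (𝟙 Y)
  tensorHom f g := Hom.prod f g
  tensorUnit := of PUnit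
  associator X Y Z := isoMk (X := of (of (X × Y) × Z)) (Y := of (X × of (Y × Z)))
    (MulEquiv.prodAssoc (M := X) (N := Y) (P := Z))
  leftUnitor X := isoMk (X := of (of PUnit × X)) (MulEquiv.uniqueProd (M := X) (N := PUnit))
  rightUnitor X := isoMk (X := of (X × of PUnit)) (MulEquiv.prodUnique (M := X) (N := PUnit))

instance : MonoidalCategory RelGrp.{u} where
  tensorHom_def f g := Hom.toRel_injective (MonoidalCategory.tensorHom_def f.toRel g.toRel)
  id_tensorHom_id X Y := Hom.toRel_injective
    (MonoidalCategory.id_tensorHom_id X.toRelSet Y.toRelSet)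
  tensorHom_comp_tensorHom f f' g g' := Hom.toRel_injective
    (MonoidalCategory.tensorHom_comp_tensorHom f.toRel f'.toRel g.toRel g'.toRel)
  whiskerLeft_id X Y := Hom.toRel_injective
    (MonoidalCategory.whiskerLeft_id X.toRelSet Y.toRelSet)
  id_whiskerRight X Y := Hom.toRel_injective
    (MonoidalCategory.id_whiskerRight X.toRelSet Y.toRelSet)
  associator_naturality f g h := Hom.toRel_injective
    (MonoidalCategory.associator_naturality f.toRel g.toRel h.toRel)
  leftUnitor_naturality f := Hom.toRel_injective
    (MonoidalCategory.leftUnitor_naturality f.toRel)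
  rightUnitor_naturality f := Hom.toRel_injective
    (MonoidalCategory.rightUnitor_naturality f.toRel)
  pentagon W X Y Z := Hom.toRel_injective
    (MonoidalCategory.pentagon W.toRelSet X.toRelSet Y.toRelSet Z.toRelSet)
  triangle X Y := Hom.toRel_injective (MonoidalCategory.triangle X.toRelSet Y.toRelSet)

instance : SymmetricCategory RelGrp.{u} where
  braiding X Y := isoMk (X := of (X × Y)) (Y := of (Y × X)) (MulEquiv.prodComm (M := X) (N := Y))
  braiding_naturality_right X _ _ f := Hom.toRel_injective
    (BraidedCategory.braiding_naturality_right X.toRelSet f.toRel)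
  braiding_naturality_left f Z := Hom.toRel_injective
    (BraidedCategory.braiding_naturality_left f.toRel Z.toRelSet)
  hexagon_forward X Y Z := Hom.toRel_injective
    (BraidedCategory.hexagon_forward X.toRelSet Y.toRelSet Z.toRelSet)
  hexagon_reverse X Y Z := Hom.toRel_injective
    (BraidedCategory.hexagon_reverse X.toRelSet Y.toRelSet Z.toRelSet)
  symmetry X Y := Hom.toRel_injective (SymmetricCategory.symmetry X.toRelSet Y.toRelSet)

/-- The dagger is the converse relation; every group is its own dual, with the diagonal as cup
and cap. -/
instance : CompactDagger RelGrp.{u} where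
  dag f := Hom.mk
    { carrier := {p | (p.2, p.1) ∈ f.sub}
      mul_mem' := fun {_ _} h h' => f.sub.mul_mem h h'
      one_mem' := f.sub.one_mem
      inv_mem' := fun {_} h => f.sub.inv_mem h }
  dag_dag _ := rfl
  dag_id X := Hom.toRel_injective (CompactDagger.dag_id X.toRelSet)
  dag_comp f g := Hom.toRel_injective (CompactDagger.dag_comp f.toRel g.toRel)
  dag_tensor _ _ := rfl
  dag_associator _ _ _ := rfl
  dag_leftUnitor _ := rfl
  dag_rightUnitor _ := rfl
  dag_braiding _ _ := rfl
  dual X := X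
  coev _ := Hom.mk
    { carrier := {p | p.2.1 = p.2.2}
      mul_mem' := fun {_ _} ha hb => congrArg₂ (· * ·) ha hb
      one_mem' := rfl
      inv_mem' := fun {_} ha => congrArg (·⁻¹) ha }
  ev _ := Hom.mk
    { carrier := {p | p.1.1 = p.1.2}
      mul_mem' := fun {_ _} ha hb => congrArg₂ (· * ·) ha hb
      one_mem' := rfl
      inv_mem' := fun {_} ha => congrArg (·⁻¹) ha }
  snake X := Hom.toRel_injective (CompactDagger.snake X.toRelSet)
  snake_dual X := Hom.toRel_injective (CompactDagger.snake_dual X.toRelSet)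
  dag_ev X := Hom.toRel_injective (CompactDagger.dag_ev X.toRelSet)

end RelGrp

/-! In `Rel`, a special dagger Frobenius structure is the set of arrows of a small groupoid, and a
relation between two groupoids is completely positive iff it is closed under inverses and under
passing to left identities (`RelSet.isCP_iff`). Consequently an object is broadcastable iff every
arrow has equal endpoints. If some arrow x has distinct endpoints, the diagonal state is entangled:
it contains (x, x), and a factorization through broadcastable objects would put (l x, r x) in it
too. So `Rel` is nonlocal. Bit commitment succeeds there because the classical structure on A ⊗ B is
arbitrary: abelian groups placed on the blocks of a partition make those blocks copyable, and the
blocks can have equal marginals without being related by a local relation.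

`Rel(Gp)` inherits the groupoid description. The one new ingredient for complete positivity is that
the ancilla must be a group; it is obtained as a quotient by a normal subgroup. Nonlocality follows
as before, with the comultiplication as broadcasting map. Every state, being a subgroup, contains
the group unit, and this determines a copyable state completely (`RelGrp.IsCopyable.eq`), so no two
distinct outcomes can be unveiled.

The category without entanglement is that of matrices over ℕ. A sum of squares of natural numbers
equal to 1 has a single nonzero term, so speciality forces every multiplication to be that of a
basis (`NatMat.isDiscrete_of_special`). Then all matrices are completely positive and all objects
broadcastable. Soundness forces the committed states to have total weight at most 1; such states are
products of their marginals, so concealing contradicts binding. -/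

/-! ### Groupoids as relations -/

/-- The arrows of a groupoid: `m x y z` says that `x` and `y` are composable with composite `z`,
and `e x` says that `x` is an identity; `l x` and `r x` are the identities at the two ends of `x`. -/
structure ArrowGroupoid {X : Type u} (m : X → X → X → Prop) (e : X → Prop) where
  l : X → X
  r : X → X
  inv : X → X
  assoc : ∀ a b c z, (∃ t, m a b t ∧ m t c z) ↔ ∃ s, m b c s ∧ m a s z
  one_mul : ∀ {i x z}, e i → m i x z → z = x
  mul_one : ∀ {i x z}, e i → m x i z → z = x
  unique : ∀ {x y z z'}, m x y z → m x y z' → z' = z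
  e_l : ∀ x, e (l x)
  e_r : ∀ x, e (r x)
  l_mul : ∀ x, m (l x) x x
  mul_r : ∀ x, m x (r x) x
  mul_inv : ∀ x, m x (inv x) (l x)
  inv_mul : ∀ x, m (inv x) x (r x)

namespace ArrowGroupoid

variable {X : Type u} {m : X → X → X → Prop} {e : X → Prop} (G : ArrowGroupoid m e)

/-- Insert the identity `r x` between `x` and `y` and reassociate; the unit law then identifies the
intermediate composite. The cancellation laws below use the same device with an inverse. -/
theorem r_mul {x y z : X} (h : m x y z) : m (G.r x) y y := by
  obtain ⟨s, h1, -⟩ := (G.assoc x (G.r x) y z).1 ⟨x, G.mul_r x, h⟩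
  exact G.one_mul (G.e_r x) h1 ▸ h1

theorem mul_l {x y z : X} (h : m x y z) : m x (G.l y) x := by
  obtain ⟨s, h1, -⟩ := (G.assoc x (G.l y) y z).2 ⟨y, G.l_mul y, h⟩
  exact G.mul_one (G.e_l y) h1 ▸ h1

theorem inv_mul_cancel {x y z : X} (h : m x y z) : m (G.inv x) z y := by
  obtain ⟨s, h1, h2⟩ := (G.assoc (G.inv x) x y y).1 ⟨_, G.inv_mul x, G.r_mul h⟩
  exact G.unique h h1 ▸ h2

theorem mul_inv_cancel {x y z : X} (h : m x y z) : m z (G.inv y) x := by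
  obtain ⟨s, h1, h2⟩ := (G.assoc x y (G.inv y) x).2 ⟨_, G.mul_inv y, G.mul_l h⟩
  exact G.unique h h1 ▸ h2

theorem eq_l {i x : X} (hi : e i) (h : m i x x) : G.l x = i :=
  G.one_mul hi (G.mul_l h) ▸ rfl

theorem l_eq {i : X} (hi : e i) : G.l i = i :=
  (G.mul_one hi (G.l_mul i)).symm

theorem r_eq {i : X} (hi : e i) : G.r i = i :=
  (G.one_mul hi (G.mul_r i)).symm

theorem l_eq_l {x y z : X} (h : m x y z) : G.l z = G.l x := by
  obtain ⟨s, h1, h2⟩ := (G.assoc (G.l x) x y z).1 ⟨x, G.l_mul x, h⟩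
  exact G.eq_l (G.e_l x) (G.unique h h1 ▸ h2)

theorem l_eq_r {x y z : X} (h : m x y z) : G.l y = G.r x :=
  G.eq_l (G.e_r x) (G.r_mul h)

theorem eq_inv {x y i : X} (hi : e i) (h : m x y i) : y = G.inv x :=
  G.mul_one hi (G.inv_mul_cancel h)

theorem inv_eq {i : X} (hi : e i) : G.inv i = i := by
  have h := G.mul_r i
  rw [G.r_eq hi] at h
  exact (G.eq_inv hi h).symm

theorem l_inv (x : X) : G.l (G.inv x) = G.r x :=
  (G.l_eq_l (G.inv_mul x)).symm.trans (G.l_eq (G.e_r x))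

/-- The inverse of a composite. -/
theorem inv_mul_inv {x y z : X} (h : m x y z) : m (G.inv y) (G.inv x) (G.inv z) :=
  G.mul_inv_cancel (G.inv_mul_cancel (G.mul_inv_cancel h))

/-- The product of two groupoids. -/
def prod {Y : Type u} {n : Y → Y → Y → Prop} {d : Y → Prop} (H : ArrowGroupoid n d) :
    ArrowGroupoid (fun p q s : X × Y => m p.1 q.1 s.1 ∧ n p.2 q.2 s.2)
      (fun p => e p.1 ∧ d p.2) where
  l p := (G.l p.1, H.l p.2)
  r p := (G.r p.1, H.r p.2)
  inv p := (G.inv p.1, H.inv p.2)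
  assoc a b c z := by
    have h1 := G.assoc a.1 b.1 c.1 z.1
    have h2 := H.assoc a.2 b.2 c.2 z.2
    constructor
    · rintro ⟨t, ⟨h3, h4⟩, h5, h6⟩
      obtain ⟨s, h7, h8⟩ := h1.1 ⟨_, h3, h5⟩
      obtain ⟨s', h7', h8'⟩ := h2.1 ⟨_, h4, h6⟩
      exact ⟨(s, s'), ⟨h7, h7'⟩, h8, h8'⟩
    · rintro ⟨t, ⟨h3, h4⟩, h5, h6⟩
      obtain ⟨s, h7, h8⟩ := h1.2 ⟨_, h3, h5⟩
      obtain ⟨s', h7', h8'⟩ := h2.2 ⟨_, h4, h6⟩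
      exact ⟨(s, s'), ⟨h7, h7'⟩, h8, h8'⟩
  one_mul h h' := Prod.ext (G.one_mul h.1 h'.1) (H.one_mul h.2 h'.2)
  mul_one h h' := Prod.ext (G.mul_one h.1 h'.1) (H.mul_one h.2 h'.2)
  unique h h' := Prod.ext (G.unique h.1 h'.1) (H.unique h.2 h'.2)
  e_l p := ⟨G.e_l p.1, H.e_l p.2⟩
  e_r p := ⟨G.e_r p.1, H.e_r p.2⟩
  l_mul p := ⟨G.l_mul p.1, H.l_mul p.2⟩
  mul_r p := ⟨G.mul_r p.1, H.mul_r p.2⟩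
  mul_inv p := ⟨G.mul_inv p.1, H.mul_inv p.2⟩
  inv_mul p := ⟨G.inv_mul p.1, H.inv_mul p.2⟩

/-- The groupoid with one arrow. -/
def punit : ArrowGroupoid (fun _ _ _ : PUnit.{u + 1} => True) (fun _ => True) where
  l := id
  r := id
  inv := id
  assoc _ _ _ _ := by simp
  one_mul _ _ := rfl
  mul_one _ _ := rfl
  unique _ _ := rfl
  e_l _ := trivial
  e_r _ := trivial
  l_mul _ := trivial
  mul_r _ := trivial
  mul_inv _ := trivial
  inv_mul _ := trivial

end ArrowGroupoid

/-- The two-sided translation action of a relation `f` between the arrows of two groupoids. -/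
def translation {X Y : Type u} (m : X → X → X → Prop) (n : Y → Y → Y → Prop) (f : X → Y → Prop)
    (p q : X × Y) : Prop :=
  ∃ x y, f x y ∧ m p.1 x q.1 ∧ n p.2 y q.2

/-- The translation action is positive iff `f` is closed under inverses and left identities. -/
theorem ArrowGroupoid.translation_positive_iff {X Y : Type u} {m : X → X → X → Prop} {e : X → Prop}
    (G : ArrowGroupoid m e) {n : Y → Y → Y → Prop} {d : Y → Prop} (H : ArrowGroupoid n d)
    (f : X → Y → Prop) :
    (∀ p q, translation m n f p q → translation m n f q p ∧ translation m n f p p) ↔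
      ∀ x y, f x y → f (G.inv x) (H.inv y) ∧ f (G.l x) (H.l y) := by
  constructor
  · intro h x y hf
    -- Starting from identities, translation by (x, y) ends at (x, y). The way back can only be
    -- translation by the inverses, and staying put only translation by the identities.
    obtain ⟨⟨a, b, h1, h2, h3⟩, a', b', h4, h5, h6⟩ :=
      h (G.l x, H.l y) (x, y) ⟨x, y, hf, G.l_mul x, H.l_mul y⟩
    obtain rfl := G.eq_inv (G.e_l x) h2
    obtain rfl := H.eq_inv (H.e_l y) h3
    obtain h7 : G.l x = a' := G.one_mul (G.e_l x) h5
    obtain h8 : H.l y = b' := H.one_mul (H.e_l y) h6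
    exact ⟨h1, h7 ▸ h8 ▸ h4⟩
  · rintro h ⟨a, b⟩ ⟨c, d⟩ ⟨x, y, hf, h1, h2⟩
    obtain ⟨h3, h4⟩ := h x y hf
    exact ⟨⟨_, _, h3, G.mul_inv_cancel h1, H.mul_inv_cancel h2⟩, _, _, h4, G.mul_l h1, H.mul_l h2⟩

/-! ### Elementwise form of the CP* ingredients in `Rel` -/

namespace RelSet
open CompactDagger

variable {X Y : RelSet.{u}}

theorem R_action [MonObj X] (x : X) (p : (dual X ⊗ X : RelSet)) :
    Hom.R (action X) x p ↔ Hom.R (μ : X ⊗ X ⟶ X) (p.1, x) p.2 := by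
  constructor
  · rintro ⟨⟨⟨⟩, _⟩, h1, ⟨⟨_, _⟩, _⟩, ⟨h2, h2'⟩, ⟨_, _, _⟩, h3, h4, h5⟩
    cases h1; cases h2; cases h2'; cases h3; cases h4
    exact h5
  · intro h
    exact ⟨(⟨⟩, x), rfl, ((p.1, p.1), x), ⟨rfl, rfl⟩, (p.1, p.1, x), rfl, rfl, h⟩

/-- Conjugation does not change a relation, so the two copies of `g` interact only through the
shared value on the `Z`-wire. -/
theorem R_doubling {Z : RelSet.{u}} (g : X ⟶ Z ⊗ Y) (p : (dual X ⊗ X : RelSet))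
    (q : (dual Y ⊗ Y : RelSet)) :
    Hom.R (doubling g) p q ↔ ∃ z, g.R p.1 (z, q.1) ∧ g.R p.2 (z, q.2) := by
  constructor
  · obtain ⟨c, d⟩ := q
    rintro ⟨⟨a, z, c⟩, ⟨h1, h2⟩, ⟨⟨_, _⟩, _⟩, h3, h4, h5⟩
    cases h1; cases h3; cases h5
    obtain ⟨⟨⟨_, _⟩, ⟨⟩⟩, h1, ⟨⟨_, _⟩, ⟨_, _⟩⟩, ⟨h5, h6⟩, ⟨⟨⟨_, _⟩, _⟩, _⟩, h7,
      ⟨⟨_, ⟨_, _⟩⟩, _⟩, ⟨h8, h9⟩, ⟨⟨_, _⟩, _⟩, ⟨⟨h10, h10'⟩, h11⟩, ⟨⟨⟩, _⟩, ⟨h12, h12'⟩, h13⟩ := h4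
    cases h1; cases h5; cases h7; cases h8; cases h9; cases h10; cases h11; cases h12'; cases h13
    cases h6; cases h12
    exact ⟨_, h10', h2⟩
  · rintro ⟨z, h1, h2⟩
    obtain ⟨a, b⟩ := p
    obtain ⟨c, d⟩ := q
    exact ⟨(a, z, d), ⟨rfl, h2⟩, ((a, z), d), rfl, ⟨((a, z), ⟨⟩), rfl, ((a, z), (c, c)), ⟨rfl, rfl⟩,
      (((a, z), c), c), rfl, ((a, (z, c)), c), ⟨rfl, rfl⟩, ((a, a), c), ⟨⟨rfl, h1⟩, rfl⟩,
      (⟨⟩, c), ⟨rfl, rfl⟩, rfl⟩, rfl⟩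

theorem R_tensorμ (p : ((X ⊗ Y) ⊗ (X ⊗ Y) : RelSet)) (q : ((X ⊗ X) ⊗ (Y ⊗ Y) : RelSet)) :
    Hom.R (tensorμ X Y X Y) p q ↔ q = ((p.1.1, p.2.1), (p.1.2, p.2.2)) := by
  constructor
  · obtain ⟨⟨a, b⟩, c, d⟩ := p
    rintro ⟨_, h1, ⟨_, _, _⟩, ⟨h2, h2'⟩, ⟨_, ⟨_, _⟩, _⟩, ⟨h3, h3', h3''⟩, ⟨_, _, _, _⟩, ⟨h4, h4'⟩, h5⟩
    cases h1; cases h2; cases h2'; cases h3; cases h3'; cases h3''; cases h4; cases h4'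
    exact (Equiv.eq_symm_apply _).2 h5
  · rintro rfl
    exact ⟨_, rfl, (p.1.1, (p.1.2, p.2.1), p.2.2), ⟨rfl, rfl⟩, (p.1.1, (p.2.1, p.1.2), p.2.2),
      ⟨rfl, rfl, rfl⟩, (p.1.1, p.2.1, p.1.2, p.2.2), ⟨rfl, rfl⟩, rfl⟩

theorem R_tensor_mul [MonObj X] [MonObj Y] (p q r : (X ⊗ Y : RelSet)) :
    Hom.R (μ : (X ⊗ Y) ⊗ (X ⊗ Y) ⟶ (X ⊗ Y)) (p, q) r ↔
      Hom.R (μ : X ⊗ X ⟶ X) (p.1, q.1) r.1 ∧ Hom.R (μ : Y ⊗ Y ⟶ Y) (p.2, q.2) r.2 := by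
  rw [MonObj.tensorObj.mul_def]
  constructor
  · rintro ⟨s, h1, h2, h3⟩
    obtain rfl := (R_tensorμ _ _).1 h1
    exact ⟨h2, h3⟩
  · rintro ⟨h1, h2⟩
    exact ⟨_, (R_tensorμ _ _).2 rfl, h1, h2⟩

end RelSet

/-! ### Counit laws -/

namespace CompactDagger

variable {C : Type u} [Category.{v} C] [MonoidalCategory C] [SymmetricCategory C] [CompactDagger C]

/-- The dagger of the unit law. With its mirror image it gives `comul` both marginals of a
broadcasting map, so only complete positivity of `comul` remains to be checked. -/
theorem comul_counit_left (X : C) [MonObj X] :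
    comul X ≫ counit X ▷ X ≫ (λ_ X).hom = 𝟙 X := by
  have h := congrArg dag (MonObj.one_mul X)
  rw [dag_comp, ← tensorHom_id, dag_tensor, dag_id, dag_leftUnitor, tensorHom_id] at h
  rw [← Category.assoc, comul, counit, h, Iso.inv_hom_id]

theorem comul_counit_right (X : C) [MonObj X] :
    comul X ≫ X ◁ counit X ≫ (ρ_ X).hom = 𝟙 X := by
  have h := congrArg dag (MonObj.mul_one X)
  rw [dag_comp, ← id_tensorHom, dag_tensor, dag_id, dag_rightUnitor, id_tensorHom] at h
  rw [← Category.assoc, comul, counit, h, Iso.inv_hom_id]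

end CompactDagger

/-! ### Frobenius structures in `Rel` as groupoids -/

namespace RelSet
open CompactDagger

variable {X Y : RelSet.{u}}

theorem R_congr {f g : X ⟶ Y} (h : f = g) (x : X) (y : Y) : f.R x y ↔ g.R x y := by rw [h]

/-- The multiplication of a monoid in `Rel`. -/
def mulRel (X : RelSet.{u}) [MonObj X] (x y z : X) : Prop :=
  Hom.R (μ : X ⊗ X ⟶ X) (x, y) z

/-- The unit of a monoid in `Rel`. -/
def oneRel (X : RelSet.{u}) [MonObj X] (x : X) : Prop :=
  Hom.R (η : 𝟙_ RelSet ⟶ X) ⟨⟩ x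

theorem mulRel_tensor [MonObj X] [MonObj Y] : mulRel (X ⊗ Y) = fun p q r =>
    mulRel X p.1 q.1 r.1 ∧ mulRel Y p.2 q.2 r.2 :=
  funext fun p => funext fun q => funext fun r => propext (R_tensor_mul p q r)

theorem mulRel_unit : mulRel (𝟙_ RelSet.{u}) = fun _ _ _ => True :=
  funext fun _ => funext fun _ => funext fun _ => eq_true rfl

section

variable [MonObj X]

theorem one_mul_iff (x z : X) : (∃ i, oneRel X i ∧ mulRel X i x z) ↔ x = z := by
  refine Iff.trans ?_ (R_congr (MonObj.one_mul X) (⟨⟩, x) z)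
  constructor
  · rintro ⟨i, h1, h2⟩
    exact ⟨(i, x), ⟨h1, rfl⟩, h2⟩
  · rintro ⟨⟨i, _⟩, ⟨h1, h2⟩, h3⟩
    cases h2
    exact ⟨i, h1, h3⟩

theorem mul_one_iff (x z : X) : (∃ i, oneRel X i ∧ mulRel X x i z) ↔ x = z := by
  refine Iff.trans ?_ (R_congr (MonObj.mul_one X) (x, ⟨⟩) z)
  constructor
  · rintro ⟨i, h1, h2⟩
    exact ⟨(x, i), ⟨rfl, h1⟩, h2⟩
  · rintro ⟨⟨_, i⟩, ⟨h1, h2⟩, h3⟩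
    cases h1
    exact ⟨i, h2, h3⟩

theorem mul_assoc_iff (a b c z : X) :
    (∃ t, mulRel X a b t ∧ mulRel X t c z) ↔ ∃ s, mulRel X b c s ∧ mulRel X a s z := by
  refine Iff.trans ?_ ((R_congr (MonObj.mul_assoc X) ((a, b), c) z).trans ?_)
  · constructor
    · rintro ⟨t, h1, h2⟩
      exact ⟨(t, c), ⟨h1, rfl⟩, h2⟩
    · rintro ⟨⟨t, _⟩, ⟨h1, h2⟩, h3⟩
      cases h2
      exact ⟨t, h1, h3⟩
  · constructor
    · rintro ⟨_, h1, ⟨_, s⟩, ⟨h2, h3⟩, h4⟩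
      cases h1; cases h2
      exact ⟨s, h3, h4⟩
    · rintro ⟨s, h1, h2⟩
      exact ⟨(a, b, c), rfl, (a, s), ⟨rfl, h1⟩, h2⟩

theorem R_frobenius_left (x y a b : X) :
    Hom.R (X ◁ comul X ≫ (α_ X X X).inv ≫ μ ▷ X) (x, y) (a, b) ↔
      ∃ c, mulRel X x c a ∧ mulRel X c b y := by
  constructor
  · rintro ⟨⟨_, c, _⟩, ⟨h1, h2⟩, ⟨⟨_, _⟩, _⟩, h3, h4, h5⟩
    cases h1; cases h3; cases h5
    exact ⟨_, h4, h2⟩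
  · rintro ⟨c, h1, h2⟩
    exact ⟨(x, c, b), ⟨rfl, h2⟩, ((x, c), b), rfl, h1, rfl⟩

theorem R_frobenius_right (x y a b : X) :
    Hom.R (comul X ▷ X ≫ (α_ X X X).hom ≫ X ◁ μ) (x, y) (a, b) ↔
      ∃ d, mulRel X a d x ∧ mulRel X d y b := by
  constructor
  · rintro ⟨⟨⟨_, d⟩, _⟩, ⟨h1, h2⟩, ⟨_, _, _⟩, h3, h4, h5⟩
    cases h2; cases h3; cases h4
    exact ⟨d, h1, h5⟩
  · rintro ⟨c, h1, h2⟩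
    exact ⟨((a, c), y), ⟨h1, rfl⟩, (a, c, y), rfl, rfl, h2⟩

theorem R_special (z z' : X) :
    Hom.R (comul X ≫ μ) z z' ↔ ∃ x y, mulRel X x y z ∧ mulRel X x y z' :=
  ⟨fun ⟨p, h1, h2⟩ => ⟨p.1, p.2, h1, h2⟩, fun ⟨x, y, h1, h2⟩ => ⟨(x, y), h1, h2⟩⟩

/-- A special dagger Frobenius structure in `Rel` is a groupoid. -/
theorem nonempty_arrowGroupoid
    (hf : X ◁ comul X ≫ (α_ X X X).inv ≫ μ ▷ X = comul X ▷ X ≫ (α_ X X X).hom ≫ X ◁ μ)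
    (hs : comul X ≫ μ = 𝟙 X) : Nonempty (ArrowGroupoid (mulRel X) (oneRel X)) := by
  have hl (x : X) := (one_mul_iff x x).2 rfl
  have hr (x : X) := (mul_one_iff x x).2 rfl
  choose l hl hl' using hl
  choose r hr hr' using hr
  have hi (x : X) : ∃ y, mulRel X x y (l x) ∧ mulRel X y x (r x) := by
    -- At these four elements the right side of the Frobenius law holds with middle element `x`; the
    -- middle element of the left side is then an inverse of `x`.
    refine (R_frobenius_left x (r x) (l x) x).1 ((R_congr hf _ _).2 ?_)
    exact (R_frobenius_right x (r x) (l x) x).2 ⟨x, hl' x, hr' x⟩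
  choose i hi hi' using hi
  exact ⟨{
    l := l
    r := r
    inv := i
    assoc := mul_assoc_iff
    one_mul := fun h h' => ((one_mul_iff _ _).1 ⟨_, h, h'⟩).symm
    mul_one := fun h h' => ((mul_one_iff _ _).1 ⟨_, h, h'⟩).symm
    -- Two values of one product are related by `comul ≫ μ`, which is the identity.
    unique := fun h h' => ((R_congr hs _ _).1 ((R_special _ _).2 ⟨_, _, h, h'⟩)).symm
    e_l := hl
    e_r := hr
    l_mul := hl'
    mul_r := hr'
    mul_inv := hi
    inv_mul := hi' }⟩

end

/-! ### Completely positive relations -/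

theorem R_coaction_comp_action [MonObj X] [MonObj Y] (f : X ⟶ Y) (p : (dual X ⊗ X : RelSet))
    (q : (dual Y ⊗ Y : RelSet)) : Hom.R (coaction X ≫ f ≫ action Y) p q ↔
      translation (mulRel X) (mulRel Y) f.R (p.1, q.1) (p.2, q.2) := by
  constructor
  · rintro ⟨x, h1, y, h2, h3⟩
    exact ⟨x, y, h2, (R_action x p).1 h1, (R_action y q).1 h3⟩
  · rintro ⟨x, y, h1, h2, h3⟩
    exact ⟨x, (R_action x p).2 h2, y, h1, (R_action y q).2 h3⟩

/-- With the same ancilla value, exchange the two copies of `g`, or use the first one twice. -/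
theorem R_doubling_swap {Z : RelSet.{u}} (g : X ⟶ Z ⊗ Y) {p q : X × Y}
    (h : Hom.R (doubling g) (p.1, q.1) (p.2, q.2)) :
    Hom.R (doubling g) (q.1, p.1) (q.2, p.2) ∧ Hom.R (doubling g) (p.1, p.1) (p.2, p.2) := by
  obtain ⟨z, h1, h2⟩ := (R_doubling _ _ _).1 h
  exact ⟨(R_doubling _ _ _).2 ⟨z, h2, h1⟩, (R_doubling _ _ _).2 ⟨z, h1, h1⟩⟩

/-- With the wires regrouped, a doubling is a relation on X × Y that is symmetric and reflexive on
its support. Conversely, such a relation is a graph with loops: take its edges as ancilla and let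
`g` attach each edge to its two ends. Two points share an edge exactly when they are related. -/
theorem isCP_iff_translation [MonObj X] [MonObj Y] (f : X ⟶ Y) :
    IsCP f ↔ ∀ p q, translation (mulRel X) (mulRel Y) f.R p q →
      translation (mulRel X) (mulRel Y) f.R q p ∧ translation (mulRel X) (mulRel Y) f.R p p := by
  have key (p q : X × Y) : Hom.R (coaction X ≫ f ≫ action Y) (p.1, q.1) (p.2, q.2) ↔
    translation (mulRel X) (mulRel Y) f.R p q := R_coaction_comp_action f (p.1, q.1) (p.2, q.2)
  constructor
  · rintro ⟨Z, g, h⟩ p q hpq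
    obtain ⟨h1, h2⟩ := R_doubling_swap g ((R_congr h _ _).1 ((key p q).2 hpq))
    exact ⟨(key q p).1 ((R_congr h _ _).2 h1), (key p p).1 ((R_congr h _ _).2 h2)⟩
  · intro h
    refine ⟨.of {z : (X × Y) × (X × Y) // translation (mulRel X) (mulRel Y) f.R z.1 z.2},
      .mk fun x q => q.1.1.1 = (x, q.2) ∨ q.1.1.2 = (x, q.2), ?_⟩
    ext ⟨a, b⟩ ⟨c, d⟩
    refine (key (a, c) (b, d)).trans (Iff.trans ?_ (R_doubling _ _ _).symm)
    constructor
    · exact fun h1 => ⟨⟨((a, c), b, d), h1⟩, .inl rfl, .inr rfl⟩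
    · rintro ⟨⟨⟨p, q⟩, h1⟩, h2, h3⟩
      obtain h2 | h2 : p = (a, c) ∨ q = (a, c) := h2 <;>
      obtain h3 | h3 : p = (b, d) ∨ q = (b, d) := h3 <;> rw [← h2, ← h3]
      · exact (h _ _ h1).2
      · exact h1
      · exact (h _ _ h1).1
      · exact (h _ _ (h _ _ h1).1).2

/-- The multiplications enter through equations because those of a tensor product and of the tensor
unit are known only up to `mulRel_tensor` and `mulRel_unit`. -/
theorem isCP_iff [MonObj X] [MonObj Y] {m : X → X → X → Prop} {e : X → Prop}
    {n : Y → Y → Y → Prop} {d : Y → Prop} (hm : mulRel X = m) (hn : mulRel Y = n)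
    (G : ArrowGroupoid m e) (H : ArrowGroupoid n d) (f : X ⟶ Y) :
    IsCP f ↔ ∀ x y, f.R x y → f.R (G.inv x) (H.inv y) ∧ f.R (G.l x) (H.l y) := by
  subst hm hn
  exact (isCP_iff_translation f).trans (G.translation_positive_iff H f.R)

/-! ### Broadcasting and entanglement -/

theorem R_counit_left [MonObj X] (b : X ⟶ X ⊗ X) (x z : X) :
    Hom.R (b ≫ counit X ▷ X ≫ (λ_ X).hom) x z ↔ ∃ i, oneRel X i ∧ b.R x (i, z) := by
  constructor
  · rintro ⟨⟨i, _⟩, h1, ⟨⟨⟩, _⟩, ⟨h2, h2'⟩, h3⟩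
    cases h2'; cases h3
    exact ⟨i, h2, h1⟩
  · rintro ⟨i, h1, h2⟩
    exact ⟨(i, z), h2, (⟨⟩, z), ⟨h1, rfl⟩, rfl⟩

theorem R_counit_right [MonObj X] (b : X ⟶ X ⊗ X) (x z : X) :
    Hom.R (b ≫ X ◁ counit X ≫ (ρ_ X).hom) x z ↔ ∃ i, oneRel X i ∧ b.R x (z, i) := by
  constructor
  · rintro ⟨⟨_, i⟩, h1, ⟨_, ⟨⟩⟩, ⟨h2, h2'⟩, h3⟩
    cases h2; cases h3
    exact ⟨i, h2', h1⟩
  · rintro ⟨i, h1, h2⟩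
    exact ⟨(z, i), h2, (z, ⟨⟩), ⟨rfl, h1⟩, rfl⟩

/-- A groupoid with a broadcasting map is totally disconnected. -/
theorem l_eq_r_of_broadcast [MonObj X] (G : ArrowGroupoid (mulRel X) (oneRel X)) (b : X ⟶ X ⊗ X)
    (hb : ∀ x p, b.R x p → b.R (G.inv x) ((G.prod G).inv p) ∧ b.R (G.l x) ((G.prod G).l p))
    (h : b ≫ counit X ▷ X ≫ (λ_ X).hom = 𝟙 X) (h' : b ≫ X ◁ counit X ≫ (ρ_ X).hom = 𝟙 X) (x : X) :
    G.l x = G.r x := by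
  -- The left marginal yields an identity `i` with `b` relating `x` to (i, x). By positivity `b`
  -- relates `l x` to (i, l x), and the right marginal then gives l x = i. The same argument for the
  -- inverse of `x` gives r x = i.
  obtain ⟨i, hi, h1⟩ := (R_counit_left b x x).1 ((R_congr h x x).2 rfl)
  have key (y : X) (h1 : b.R y (i, y)) : G.l y = i := by
    have h2 : b.R (G.l y) (G.l i, G.l y) := (hb _ _ h1).2
    rw [G.l_eq hi] at h2
    exact (R_congr h' _ _).1 ((R_counit_right b _ _).2 ⟨_, G.e_l y, h2⟩)
  have h2 : b.R (G.inv x) (G.inv i, G.inv x) := (hb _ _ h1).1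
  rw [G.inv_eq hi] at h2
  rw [key x h1, ← G.l_inv, key _ h2]

/-- A totally disconnected groupoid has a broadcasting map. -/
theorem isBroadcastable_of_l_eq_r (A : CPStar RelSet.{u})
    (G : ArrowGroupoid (mulRel A.X) (oneRel A.X)) (h : ∀ x, G.l x = G.r x) :
    IsBroadcastable A := by
  -- `comul` would be closed under inverses only for commutative vertex groups. Here each of the two
  -- alternatives provides one marginal, and contributes nothing wrong to the other since it
  -- survives there only when `x` is an identity.
  refine ⟨.mk fun x p => p = (G.l x, x) ∨ p = (x, G.l x), ?_, ?_, ?_⟩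
  · refine (isCP_iff rfl mulRel_tensor G (G.prod G) _).2 ?_
    have h1 (x : A.X) : G.inv (G.l x) = G.l (G.inv x) := by
      rw [G.inv_eq (G.e_l x), G.l_inv, h]
    rintro x p (rfl | rfl)
    · exact ⟨.inl (Prod.ext (h1 x) rfl), .inl rfl⟩
    · exact ⟨.inr (Prod.ext rfl (h1 x)), .inr rfl⟩
  · ext x z
    refine (R_counit_left _ x z).trans ⟨?_, fun hxz => ⟨G.l x, G.e_l x, .inl ?_⟩⟩
    · rintro ⟨i, hi, h1 | h1⟩ <;> obtain ⟨rfl, rfl⟩ := Prod.mk.inj h1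
      · rfl
      · exact (G.l_eq hi).symm
    · rw [(hxz : x = z)]
  · ext x z
    refine (R_counit_right _ x z).trans ⟨?_, fun hxz => ⟨G.l x, G.e_l x, .inr ?_⟩⟩
    · rintro ⟨i, hi, h1 | h1⟩ <;> obtain ⟨rfl, rfl⟩ := Prod.mk.inj h1
      · exact (G.l_eq hi).symm
      · rfl
    · rw [(hxz : x = z)]

/-- If a state of a product of groupoids contains a pair of arrows and factors through totally
disconnected groupoids, then it contains an endpoint of the first paired with the opposite endpoint
of the second. -/
theorem R_of_eq_comp_tensorHom {A B : RelSet.{u}} [MonObj X] [MonObj Y] [MonObj A] [MonObj B]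
    (GX : ArrowGroupoid (mulRel X) (oneRel X)) (GY : ArrowGroupoid (mulRel Y) (oneRel Y))
    (GA : ArrowGroupoid (mulRel A) (oneRel A)) (GB : ArrowGroupoid (mulRel B) (oneRel B))
    (hB : ∀ b, GB.l b = GB.r b) {ω : 𝟙_ RelSet.{u} ⟶ X ⊗ Y} {ψ : 𝟙_ RelSet.{u} ⟶ A ⊗ B}
    {f : A ⟶ X} {g : B ⟶ Y} (hω : ω = ψ ≫ (f ⊗ₘ g))
    (hψ : ∀ p, ψ.R ⟨⟩ p → ψ.R ⟨⟩ ((GA.prod GB).l p))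
    (hf : ∀ a x, f.R a x → f.R (GA.l a) (GX.l x))
    (hg : ∀ b y, g.R b y → g.R (GB.inv b) (GY.inv y) ∧ g.R (GB.l b) (GY.l y))
    {x : X} {y : Y} (h : ω.R ⟨⟩ (x, y)) : ω.R ⟨⟩ (GX.l x, GY.r y) := by
  subst hω
  obtain ⟨⟨a, b⟩, h1, h2, h3⟩ := h
  refine ⟨_, hψ _ h1, hf _ _ h2, ?_⟩
  -- Since the endpoints of `b` agree, `l b` is also the left identity of its inverse, so `g`
  -- relates it to the left identity of y⁻¹, which is `r y`.
  have h4 := (hg _ _ (hg _ _ h3).1).2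
  rwa [GB.l_inv, GY.l_inv, ← hB] at h4

end RelSet

/-! ### Examples of groupoids -/

namespace ArrowGroupoid

/-- The pair groupoid on a set: one arrow between any two points. -/
def pair (α : Type u) : ArrowGroupoid (fun p q s : α × α => p.2 = q.1 ∧ (p.1, q.2) = s)
    (fun p => p.1 = p.2) where
  l p := (p.1, p.1)
  r p := (p.2, p.2)
  inv p := p.swap
  assoc := by
    rintro ⟨a, b⟩ ⟨c, d⟩ ⟨x, y⟩ ⟨z, w⟩
    simp only [Prod.exists, Prod.mk.injEq]
    grind
  one_mul {i x z} h h' := by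
    rw [← h'.2, h, h'.1]
  mul_one {i x z} h h' := by
    rw [← h'.2, ← h, ← h'.1]
  unique h h' := h'.2.symm.trans h.2
  e_l _ := rfl
  e_r _ := rfl
  l_mul _ := ⟨rfl, rfl⟩
  mul_r _ := ⟨rfl, rfl⟩
  mul_inv _ := ⟨rfl, rfl⟩
  inv_mul _ := ⟨rfl, rfl⟩

/-- A disjoint union of copies of a group, indexed by `K`. -/
def bundle {X : Type u} {K A : Type*} [AddCommGroup A] (φ : X ≃ K × A) : ArrowGroupoid
    (fun x y z : X => (φ x).1 = (φ y).1 ∧ ((φ x).1, (φ x).2 + (φ y).2) = φ z)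
    (fun x => (φ x).2 = 0) where
  l x := φ.symm ((φ x).1, 0)
  r x := φ.symm ((φ x).1, 0)
  inv x := φ.symm ((φ x).1, -(φ x).2)
  assoc a b c z := by
    constructor
    · rintro ⟨t, ⟨h1, h2⟩, h3, h4⟩
      rw [← h2] at h3 h4
      refine ⟨φ.symm ((φ b).1, (φ b).2 + (φ c).2), ⟨h1.symm.trans h3, by simp⟩, by simpa, ?_⟩
      simpa [add_assoc] using h4
    · rintro ⟨t, ⟨h1, h2⟩, h3, h4⟩
      rw [← h2] at h3 h4
      refine ⟨φ.symm ((φ a).1, (φ a).2 + (φ b).2), ⟨h3, by simp⟩, by simpa using h3.trans h1, ?_⟩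
      simpa [add_assoc] using h4
  one_mul {i x z} h h' := φ.injective (by rw [← h'.2, h, zero_add, h'.1])
  mul_one {i x z} h h' := φ.injective (by rw [← h'.2, h, add_zero])
  unique h h' := φ.injective (h'.2.symm.trans h.2)
  e_l _ := by simp
  e_r _ := by simp
  l_mul _ := by simp
  mul_r _ := by simp
  mul_inv _ := by simp
  inv_mul _ := by simp

end ArrowGroupoid

/-! ### From groupoids to Frobenius structures in `Rel` -/

namespace RelSet
open CompactDagger

section
variable {X : Type u} {m : X → X → X → Prop} {e : X → Prop} (G : ArrowGroupoid m e)

/-- The monoid in `Rel` given by the composition of a groupoid. -/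
abbrev monObj : MonObj (RelSet.of X) where
  one := .mk fun _ x => e x
  mul := .mk fun p z => m p.1 p.2 z
  one_mul := by
    ext ⟨⟨⟩, x⟩ z
    constructor
    · rintro ⟨⟨i, _⟩, ⟨h1, h2⟩, h3⟩
      cases h2
      exact (G.one_mul h1 h3).symm
    · intro h
      obtain rfl : x = z := h
      exact ⟨(G.l x, x), ⟨G.e_l x, rfl⟩, G.l_mul x⟩
  mul_one := by
    ext ⟨x, ⟨⟩⟩ z
    constructor
    · rintro ⟨⟨_, i⟩, ⟨h1, h2⟩, h3⟩
      cases h1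
      exact (G.mul_one h2 h3).symm
    · intro h
      obtain rfl : x = z := h
      exact ⟨(x, G.r x), ⟨rfl, G.e_r x⟩, G.mul_r x⟩
  mul_assoc := by
    ext ⟨⟨a, b⟩, c⟩ z
    constructor
    · rintro ⟨⟨t, _⟩, ⟨h1, h2⟩, h3⟩
      cases h2
      obtain ⟨s, h4, h5⟩ := (G.assoc a b c z).1 ⟨t, h1, h3⟩
      exact ⟨(a, b, c), rfl, (a, s), ⟨rfl, h4⟩, h5⟩
    · rintro ⟨⟨_, _, _⟩, h1, ⟨_, s⟩, ⟨h2, h3⟩, h4⟩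
      cases h1; cases h2
      obtain ⟨t, h5, h6⟩ := (G.assoc a b c z).2 ⟨s, h3, h4⟩
      exact ⟨(t, c), ⟨h5, rfl⟩, h6⟩

/-- The middle elements on the two sides of the Frobenius law are inverse to each other. -/
theorem monObj_frobenius : letI := monObj G
    (of X) ◁ comul (of X) ≫ (α_ (of X) (of X) (of X)).inv ≫ μ ▷ (of X) =
      comul (of X) ▷ (of X) ≫ (α_ (of X) (of X) (of X)).hom ≫ (of X) ◁ μ := by
  let := monObj G
  ext ⟨x, y⟩ ⟨a, b⟩
  refine (R_frobenius_left x y a b).trans (Iff.trans ?_ (R_frobenius_right x y a b).symm)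
  constructor
  · rintro ⟨c, h1, h2⟩
    exact ⟨G.inv c, G.mul_inv_cancel h1, G.inv_mul_cancel h2⟩
  · rintro ⟨c, h1, h2⟩
    exact ⟨G.inv c, G.mul_inv_cancel h1, G.inv_mul_cancel h2⟩

theorem monObj_special : letI := monObj G
    comul (of X) ≫ μ = 𝟙 (of X) := by
  let := monObj G
  ext z z'
  refine (R_special z z').trans ⟨?_, ?_⟩
  · rintro ⟨x, y, h1, h2⟩
    exact (G.unique h1 h2).symm
  · intro h
    obtain rfl : z = z' := h
    exact ⟨_, _, G.l_mul z, G.l_mul z⟩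

theorem monObj_symmetric : letI := monObj G
    (β_ (of X) (of X)).hom ≫ μ ≫ counit (of X) = μ ≫ counit (of X) := by
  let := monObj G
  have key {x y z : X} (h : m x y z) (hz : e z) : ∃ i, m y x i ∧ e i :=
    ⟨_, G.eq_inv hz h ▸ G.inv_mul x, G.e_r x⟩
  ext ⟨x, y⟩ ⟨⟩
  constructor
  · rintro ⟨_, h1, z, h2, h3⟩
    cases h1
    exact key h2 h3
  · rintro ⟨z, h2, h3⟩
    exact ⟨(y, x), rfl, key h2 h3⟩

/-- The object of `CP*[Rel]` given by a groupoid. -/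
def cpStar : CPStar RelSet.{u} :=
  letI := monObj G
  { X := of X, frob := ⟨monObj_frobenius G, monObj_symmetric G, monObj_special G⟩ }

theorem monObj_isClassicalStructure (h : ∀ {x y z}, m x y z → m y x z) :
    @IsClassicalStructure _ _ _ _ _ (of X) (monObj G) := by
  let := monObj G
  refine ⟨monObj_frobenius G, ?_, monObj_special G⟩
  ext ⟨x, y⟩ z
  constructor
  · rintro ⟨_, h1, h2⟩
    cases h1
    exact h h2
  · exact fun h2 => ⟨(y, x), rfl, h h2⟩

end

/-! ### Nonlocality of `Rel` -/

theorem CPStar.nonempty_arrowGroupoid (A : CPStar RelSet.{u}) :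
    Nonempty (ArrowGroupoid (mulRel A.X) (oneRel A.X)) :=
  RelSet.nonempty_arrowGroupoid A.frob.frobenius A.frob.special

theorem l_eq_r_of_isBroadcastable {A : CPStar RelSet.{u}} (h : IsBroadcastable A)
    (G : ArrowGroupoid (mulRel A.X) (oneRel A.X)) (x : A.X) : G.l x = G.r x := by
  obtain ⟨b, hb, h1, h2⟩ := h
  exact l_eq_r_of_broadcast G b ((isCP_iff rfl mulRel_tensor G (G.prod G) b).1 hb) h1 h2 x

/-- The witness is the diagonal. It contains (x, x), so by `R_of_eq_comp_tensorHom` a factorization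
would put (l x, r x) on the diagonal. -/
theorem admitsEntanglement_of_l_ne_r (A : CPStar RelSet.{u})
    (G : ArrowGroupoid (mulRel A.X) (oneRel A.X)) {x : A.X} (h : G.l x ≠ G.r x) :
    AdmitsEntanglement A := by
  refine ⟨A, .mk fun _ p => p.1 = p.2, ?_, ?_⟩
  · refine (isCP_iff mulRel_unit mulRel_tensor .punit (G.prod G) _).2 ?_
    rintro ⟨⟩ ⟨a, b⟩ hab
    obtain rfl : a = b := hab
    exact ⟨rfl, rfl⟩
  · rintro ⟨A', B', ψ, f, g, hA, hB, hψ, hf, hg, hω⟩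
    obtain ⟨GA⟩ := CPStar.nonempty_arrowGroupoid A'
    obtain ⟨GB⟩ := CPStar.nonempty_arrowGroupoid B'
    have hψ := (isCP_iff mulRel_unit mulRel_tensor .punit (GA.prod GB) ψ).1 hψ
    have hf := (isCP_iff rfl rfl GA G f).1 hf
    have hg := (isCP_iff rfl rfl GB G g).1 hg
    exact h (R_of_eq_comp_tensorHom G G GA GB (l_eq_r_of_isBroadcastable hB GB) hω
      (fun p hp => (hψ ⟨⟩ p hp).2) (fun a y hy => (hf a y hy).2) hg (x := x) (y := x) rfl)

theorem nonlocal : Nonlocal RelSet.{u} := by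
  refine ⟨⟨cpStar (.pair (ULift.{u} Bool)), fun h => ?_⟩, fun A hA => ?_⟩
  · have := l_eq_r_of_isBroadcastable h (.pair (ULift.{u} Bool)) (⟨true⟩, ⟨false⟩)
    exact absurd (congrArg (fun p => p.1.down) this) (by simp [ArrowGroupoid.pair])
  · obtain ⟨G⟩ := CPStar.nonempty_arrowGroupoid A
    by_contra h
    refine hA (isBroadcastable_of_l_eq_r A G fun x => ?_)
    by_contra hx
    exact h (admitsEntanglement_of_l_ne_r A G hx)

/-! ### Bit commitment in `Rel` -/

theorem isCP_id {X : RelSet.{u}} [MonObj X] {m : X → X → X → Prop} {e : X → Prop}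
    (hm : mulRel X = m) (G : ArrowGroupoid m e) : IsCP (𝟙 X) := by
  refine (isCP_iff hm hm G G _).2 fun x y h => ?_
  obtain rfl : x = y := h
  exact ⟨rfl, rfl⟩

/-- A set, as an object of `CP*[Rel]`. -/
abbrev discrete (X : Type u) : CPStar RelSet.{u} :=
  cpStar (.bundle (Equiv.prodPUnit.{0} X).symm)

/-- In a discrete groupoid every arrow is an identity, so the closure conditions are vacuous. -/
theorem isCP_state_discrete {X Y : Type u} (f : 𝟙_ RelSet.{u} ⟶ (discrete X).X ⊗ (discrete Y).X) :
    IsCP f :=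
  (isCP_iff mulRel_unit (mulRel_tensor (X := (discrete X).X) (Y := (discrete Y).X)) .punit
    ((ArrowGroupoid.bundle _).prod (.bundle _)) f).2 fun _ _ h => ⟨h, h⟩

/-- The components of a disjoint union of abelian groups are copyable. -/
theorem isCopyable_bundle {X : Type u} {K A : Type*} [AddCommGroup A] (φ : X ≃ K × A) (k : K) :
    @IsCopyable _ _ _ _ _ (of X) (monObj (.bundle φ)) (.mk fun _ x => (φ x).1 = k) := by
  let := monObj (.bundle φ)
  ext ⟨⟩ ⟨x, y⟩
  constructor
  · rintro ⟨z, hz, h1, h2⟩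
    have hx : (φ x).1 = k := (congrArg Prod.fst h2).trans hz
    exact ⟨(⟨⟩, ⟨⟩), rfl, hx, h1.symm.trans hx⟩
  · rintro ⟨_, -, hx, hy⟩
    refine ⟨φ.symm ((φ x).1, (φ x).2 + (φ y).2), ?_, hx.trans hy.symm, ?_⟩
    · simpa using hx
    · simp

/-- A partition of six pairs into three blocks of two elements. -/
def blockEquiv : Fin 3 × Fin 2 ≃ Fin 3 × ZMod 2 where
  -- Block 0 is the diagonal of two bits, block 1 the antidiagonal, block 2 the product of the point
  -- 2 with an arbitrary bit. The second coordinate labels the elements within each block.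
  toFun p := (if p.1 = 2 then 2 else if p.1.val = p.2.val then 0 else 1, p.2)
  invFun p := (if p.1 = 2 then 2 else if p.1 = 0 then p.2.castSucc else 1 - p.2.castSucc, p.2)
  left_inv := by decide
  right_inv := by decide

/-- The blocks of `blockEquiv`. -/
def block (k : Fin 3) :
    𝟙_ RelSet.{u} ⟶ (discrete (ULift (Fin 3))).X ⊗ (discrete (ULift (Fin 2))).X :=
  .mk fun _ p => (blockEquiv (p.1.down, p.2.down)).1 = k

/-- The partition `blockEquiv` in an arbitrary universe. -/
def ulBlockEquiv : ULift.{u} (Fin 3) × ULift.{u} (Fin 2) ≃ Fin 3 × ZMod 2 :=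
  (Equiv.prodCongr Equiv.ulift Equiv.ulift).trans blockEquiv

theorem isCopyable_block (k : Fin 3) : @IsCopyable RelSet.{u} _ _ _ _
    ((discrete (ULift (Fin 3))).X ⊗ (discrete (ULift (Fin 2))).X)
    (monObj (.bundle ulBlockEquiv)) (block k) :=
  isCopyable_bundle ulBlockEquiv k

/-- A bit commitment protocol in `Rel`: commit to `H` by sharing the product of a fixed state with
an arbitrary bit, commit to `T` by sharing a perfectly correlated pair of bits. -/
def bitCommitment : BitCommitment RelSet.{u} where
  A := discrete (ULift (Fin 3))
  B := discrete (ULift (Fin 2))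
  H := block 2
  T := block 0
  isCP_H := isCP_state_discrete _
  isCP_T := isCP_state_discrete _
  unveil := 𝟙 _
  isCP_unveil := isCP_id mulRel_tensor ((ArrowGroupoid.bundle _).prod (.bundle _))
  mono_unveil W h k _ _ := by simp
  -- A copy of ℤ/2 on each block: the blocks are its components, hence copyable, and `H` and `T`
  -- need no processing before they are compared.
  cl := monObj (.bundle ulBlockEquiv)
  isClassical := monObj_isClassicalStructure _ fun h => ⟨h.1.symm, by rw [← h.2, add_comm, h.1]⟩
  Hhat := block 2
  That := block 0
  copyable_Hhat := isCopyable_block _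
  copyable_That := isCopyable_block _
  Hhat_ne_That h := by
    have h1 : (blockEquiv (2, 0)).1 = 2 ↔ (blockEquiv (2, 0)).1 = 0 :=
      R_congr h ⟨⟩ (⟨2⟩, ⟨0⟩)
    exact absurd h1 (by decide)

theorem supportsBitCommitment : SupportsBitCommitment RelSet.{u} := by
  refine ⟨bitCommitment, ⟨Category.comp_id (block 2), Category.comp_id (block 0)⟩, ?_, fun v _ h => ?_⟩
  -- Concealing: each block meets every value of the second coordinate.
  · ext ⟨⟩ ⟨⟨⟩, ⟨b⟩⟩
    have hb : ∀ (k : Fin 3) (b : Fin 2), ∃ a, (blockEquiv (a, b)).1 = k := by decide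
    have key (k : Fin 3) :
        Hom.R (block k ≫ counit (discrete (ULift (Fin 3))).X ▷ (discrete (ULift (Fin 2))).X)
          ⟨⟩ (⟨⟩, ⟨b⟩) := by
      obtain ⟨a, ha⟩ := hb k b
      exact ⟨(⟨a⟩, ⟨b⟩), ha, rfl, rfl⟩
    exact iff_of_true (key 2) (key 0)
  · have key (a : Fin 3) (b : Fin 2) :
        Hom.R (block 2 ≫ v ▷ (discrete (ULift (Fin 2))).X) ⟨⟩ (⟨a⟩, ⟨b⟩) ↔
          (blockEquiv (a, b)).1 = 0 := R_congr h ⟨⟩ (⟨a⟩, ⟨b⟩)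
    have hb : ∀ b : Fin 2, (blockEquiv (b.castSucc, b)).1 = 0 := by decide
    have ha : ∀ (a : Fin 3) (b : Fin 2), (blockEquiv (a, b)).1 = 2 → a = 2 := by decide
    -- Binding: in `H` the first coordinate is always 2, so `v` must relate 2 to both bits. It then
    -- also produces the uncorrelated pair (1, 0), which is not in `T`.
    have h1 (b : Fin 2) : v.R ⟨2⟩ ⟨b.castSucc⟩ := by
      obtain ⟨⟨⟨a⟩, _⟩, h1, h2, h3⟩ := (key b.castSucc b).2 (hb b)
      cases h3
      obtain rfl := ha a b h1
      exact h2
    have h2 := (key 1 0).1 ⟨(⟨2⟩, ⟨0⟩), (by decide : (blockEquiv (2, 0)).1 = 2), h1 1, rfl⟩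
    exact absurd h2 (by decide)

end RelSet

/-! ### Frobenius structures in `Rel(Gp)` as groupoids -/

namespace RelGrp
open CompactDagger

variable {X Y : RelGrp.{u}}

/-- The monoid in `Rel` underlying a monoid in `Rel(Gp)`. -/
instance monObjToRelSet [MonObj X] : MonObj X.toRelSet where
  one := Hom.toRel (η : 𝟙_ RelGrp ⟶ X)
  mul := Hom.toRel (μ : X ⊗ X ⟶ X)
  one_mul := congrArg Hom.toRel (MonObj.one_mul X)
  mul_one := congrArg Hom.toRel (MonObj.mul_one X)
  mul_assoc := congrArg Hom.toRel (MonObj.mul_assoc X)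

open RelSet (mulRel oneRel)

theorem mulRel_tensor [MonObj X] [MonObj Y] : mulRel (X ⊗ Y).toRelSet = fun p q r =>
    mulRel X.toRelSet p.1 q.1 r.1 ∧ mulRel Y.toRelSet p.2 q.2 r.2 :=
  RelSet.mulRel_tensor (X := X.toRelSet) (Y := Y.toRelSet)

theorem mulRel_unit : mulRel (𝟙_ RelGrp.{u}).toRelSet = fun _ _ _ => True :=
  RelSet.mulRel_unit

theorem nonempty_arrowGroupoid [MonObj X]
    (hf : X ◁ comul X ≫ (α_ X X X).inv ≫ μ ▷ X = comul X ▷ X ≫ (α_ X X X).hom ≫ X ◁ μ)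
    (hs : comul X ≫ μ = 𝟙 X) :
    Nonempty (ArrowGroupoid (mulRel X.toRelSet) (oneRel X.toRelSet)) :=
  RelSet.nonempty_arrowGroupoid (X := X.toRelSet) (congrArg Hom.toRel hf) (congrArg Hom.toRel hs)

theorem CPStar.nonempty_arrowGroupoid (A : CPStar RelGrp.{u}) :
    Nonempty (ArrowGroupoid (mulRel A.X.toRelSet) (oneRel A.X.toRelSet)) :=
  RelGrp.nonempty_arrowGroupoid A.frob.frobenius A.frob.special

/-! ### Completely positive relations -/

/-- A positive relation of groups is the congruence of a normal subgroup of its support. -/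
theorem _root_.Subgroup.exists_factorization_of_positive {G H : Type u} [Group G] [Group H]
    (k : Subgroup ((G × G) × (H × H)))
    (h : ∀ a b c d, ((a, b), (c, d)) ∈ k → ((b, a), (d, c)) ∈ k ∧ ((a, a), (c, c)) ∈ k) :
    ∃ (Z : Type u) (_ : Group Z) (g : Subgroup (G × (Z × H))), ∀ a b c d,
      ((a, b), (c, d)) ∈ k ↔ ∃ z, (a, (z, c)) ∈ g ∧ (b, (z, d)) ∈ g := by
  -- `S` is the support and `N` the class of the unit. A subgroup that is reflexive on its support
  -- is a congruence there, which replaces the set of edges used in `Rel` by the group S/N.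
  let S : Subgroup (G × H) :=
    { carrier := {s | ((s.1, s.1), (s.2, s.2)) ∈ k}
      mul_mem' := fun hs ht => k.mul_mem hs ht
      one_mem' := k.one_mem
      inv_mem' := fun hs => k.inv_mem hs }
  let N : Subgroup S :=
    { carrier := {s | ((s.1.1, 1), (s.1.2, 1)) ∈ k}
      mul_mem' := fun hs ht => by simpa using k.mul_mem hs ht
      one_mem' := k.one_mem
      inv_mem' := fun hs => by simpa using k.inv_mem hs }
  have hN : N.Normal := ⟨fun n hn g => by
    have : ((g.1.1 * n.1.1 * g.1.1⁻¹, g.1.1 * 1 * g.1.1⁻¹),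
        (g.1.2 * n.1.2 * g.1.2⁻¹, g.1.2 * 1 * g.1.2⁻¹)) ∈ k :=
      k.mul_mem (k.mul_mem g.2 hn) (k.inv_mem g.2)
    rwa [_root_.mul_one, _root_.mul_one, mul_inv_cancel, mul_inv_cancel] at this⟩
  have key (s t : S) : (s : S ⧸ N) = t ↔ ((s.1.1, t.1.1), (s.1.2, t.1.2)) ∈ k := by
    rw [QuotientGroup.eq]
    change ((s.1.1⁻¹ * t.1.1, 1), (s.1.2⁻¹ * t.1.2, 1)) ∈ k ↔ _
    constructor <;> intro hst
    · have : ((s.1.1 * (s.1.1⁻¹ * t.1.1), s.1.1 * 1), (s.1.2 * (s.1.2⁻¹ * t.1.2), s.1.2 * 1)) ∈ k :=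
        k.mul_mem s.2 hst
      rw [_root_.mul_one, _root_.mul_one, mul_inv_cancel_left, mul_inv_cancel_left] at this
      exact (h _ _ _ _ this).1
    · have : ((s.1.1⁻¹ * t.1.1, s.1.1⁻¹ * s.1.1), (s.1.2⁻¹ * t.1.2, s.1.2⁻¹ * s.1.2)) ∈ k :=
        k.mul_mem (k.inv_mem s.2) (h _ _ _ _ hst).1
      rwa [inv_mul_cancel, inv_mul_cancel] at this
  -- The factor `g` relates `a` to the class of (a, c) together with `c`.
  let φ : S →* G × ((S ⧸ N) × H) := ((MonoidHom.fst G H).comp S.subtype).prod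
    ((QuotientGroup.mk' N).prod ((MonoidHom.snd G H).comp S.subtype))
  refine ⟨S ⧸ N, inferInstance, φ.range, fun a b c d => ⟨fun hk => ?_, ?_⟩⟩
  · let s : S := ⟨(a, c), (h _ _ _ _ hk).2⟩
    let t : S := ⟨(b, d), (h _ _ _ _ (h _ _ _ _ hk).1).2⟩
    exact ⟨(s : S ⧸ N), ⟨s, rfl⟩, t, congrArg (fun z => (b, z, d)) ((key s t).2 hk).symm⟩
  · rintro ⟨z, ⟨s, hs⟩, ⟨t, ht⟩⟩
    obtain rfl : s.1.1 = a := congrArg (·.1) hs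
    obtain rfl : s.1.2 = c := congrArg (·.2.2) hs
    obtain rfl : t.1.1 = b := congrArg (·.1) ht
    obtain rfl : t.1.2 = d := congrArg (·.2.2) ht
    exact (key s t).1 ((congrArg (·.2.1) hs).trans (congrArg (·.2.1) ht).symm)

/-- The criterion for `Rel` supplies an ancilla that is only a set. It is used solely to see that
the relation is positive; the ancilla group comes from `Subgroup.exists_factorization_of_positive`.
-/
theorem isCP_iff [MonObj X] [MonObj Y] {m : X → X → X → Prop} {e : X → Prop}
    {n : Y → Y → Y → Prop} {d : Y → Prop} (hm : mulRel X.toRelSet = m) (hn : mulRel Y.toRelSet = n)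
    (G : ArrowGroupoid m e) (H : ArrowGroupoid n d) (f : X ⟶ Y) :
    IsCP f ↔ ∀ x y, f.toRel.R x y →
      f.toRel.R (G.inv x) (H.inv y) ∧ f.toRel.R (G.l x) (H.l y) := by
  refine Iff.trans ?_ (RelSet.isCP_iff (X := X.toRelSet) (Y := Y.toRelSet) hm hn G H f.toRel)
  constructor
  · rintro ⟨Z, g, h⟩
    exact ⟨Z.toRelSet, g.toRel, congrArg Hom.toRel h⟩
  · rintro ⟨Z, g, h⟩
    let k : Subgroup ((X × X) × (Y × Y)) := (coaction X ≫ f ≫ action Y).sub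
    have key (p : X × X) (q : Y × Y) : (p, q) ∈ k ↔ RelSet.Hom.R (doubling g) p q :=
      RelSet.R_congr h p q
    obtain ⟨Z, _, s, hs⟩ := k.exists_factorization_of_positive fun a b c d hk => by
      obtain ⟨h1, h2⟩ := RelSet.R_doubling_swap g (p := (a, c)) (q := (b, d)) ((key _ _).1 hk)
      exact ⟨(key _ _).2 h1, (key _ _).2 h2⟩
    let g' : X ⟶ of Z ⊗ Y := .mk s
    exact ⟨of Z, g', Hom.toRel_injective (RelSet.hom_ext fun p q =>
      (hs p.1 p.2 q.1 q.2).trans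
        (RelSet.R_doubling (X := X.toRelSet) (Y := Y.toRelSet) (Z := .of Z) g'.toRel p q).symm)⟩

/-! ### Classical structures -/

/-- Copyability says that `a` and `b` both lie in `s` iff they have a composite in `s`. The group
unit 1 lies in every state and is an identity arrow. So an element of `s` is composable with 1;
conversely, if `x` is, then xx⁻¹ = 1 lies in `s` and hence so does `x`. Thus `s` depends only on the
multiplication. -/
theorem IsCopyable.eq [MonObj X] (hX : IsClassicalStructure X) {s t : 𝟙_ RelGrp.{u} ⟶ X}
    (hs : IsCopyable X s) (ht : IsCopyable X t) : s = t := by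
  obtain ⟨G⟩ := nonempty_arrowGroupoid hX.frobenius hX.special
  have key (s : 𝟙_ RelGrp.{u} ⟶ X) (hs : IsCopyable X s) (x : X) :
      s.toRel.R ⟨⟩ x ↔ ∃ z, mulRel X.toRelSet (1 : X) x z := by
    have hc (a b : X) : (∃ z, s.toRel.R ⟨⟩ z ∧ mulRel X.toRelSet a b z) ↔
        s.toRel.R ⟨⟩ a ∧ s.toRel.R ⟨⟩ b := by
      refine (RelSet.R_congr (congrArg Hom.toRel hs) ⟨⟩ (a, b)).trans ⟨?_, ?_⟩
      · rintro ⟨⟨⟨⟩, ⟨⟩⟩, -, h⟩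
        exact h
      · exact fun h => ⟨(⟨⟩, ⟨⟩), rfl, h⟩
    have h1 : s.toRel.R ⟨⟩ (1 : X) := s.sub.one_mem
    have h2 : oneRel X.toRelSet (1 : X) := (η : 𝟙_ RelGrp ⟶ X).sub.one_mem
    constructor
    · intro hx
      obtain ⟨z, -, hz⟩ := (hc 1 x).2 ⟨h1, hx⟩
      exact ⟨z, hz⟩
    · rintro ⟨z, hz⟩
      obtain rfl := G.one_mul h2 hz
      have h3 := G.mul_inv z
      rw [G.eq_l h2 hz] at h3
      exact ((hc _ _).1 ⟨_, h1, h3⟩).1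
  refine Hom.toRel_injective (RelSet.hom_ext fun u x => ?_)
  exact (key s hs x).trans (key t ht x).symm

theorem not_supportsBitCommitment : ¬ SupportsBitCommitment RelGrp.{u} := fun ⟨P, _⟩ =>
  letI := P.cl
  P.Hhat_ne_That (IsCopyable.eq P.isClassical P.copyable_Hhat P.copyable_That)

/-! ### Nonlocality of `Rel(Gp)` -/

theorem l_eq_r_of_isBroadcastable {A : CPStar RelGrp.{u}} (h : IsBroadcastable A)
    (G : ArrowGroupoid (mulRel A.X.toRelSet) (oneRel A.X.toRelSet)) (x : A.X) :
    G.l x = G.r x := by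
  obtain ⟨b, hb, h1, h2⟩ := h
  exact RelSet.l_eq_r_of_broadcast G b.toRel
    ((isCP_iff (Y := A.X ⊗ A.X) rfl mulRel_tensor G (G.prod G) b).1 hb)
    (congrArg Hom.toRel h1) (congrArg Hom.toRel h2) x

/-- A totally disconnected internal groupoid in groups is commutative. -/
theorem mul_comm_of_l_eq_r [MonObj X] (G : ArrowGroupoid (mulRel X.toRelSet) (oneRel X.toRelSet))
    (h : ∀ x, G.l x = G.r x) {a b c : X} (hab : mulRel X.toRelSet a b c) :
    mulRel X.toRelSet b a c := by
  let M := (μ : X ⊗ X ⟶ X).sub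
  let i : X := G.l a
  have hi : G.l b = i := (G.l_eq_r hab).trans (h a).symm
  have h1 : ((i, a), a) ∈ M := G.l_mul a
  have h2 : ((a, i), a) ∈ M := by
    have h2 : mulRel X.toRelSet a (G.r a) a := G.mul_r a
    rwa [← h a] at h2
  have h3 : ((i, b), b) ∈ M := hi ▸ G.l_mul b
  have h4 : ((b, i), b) ∈ M := by
    have h4 : mulRel X.toRelSet b (G.r b) b := G.mul_r b
    rwa [← h b, hi] at h4
  have h5 : ((i, i), i) ∈ M := by
    have := G.l_mul i
    rwa [G.l_eq (G.e_l a)] at this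
  -- An Eckmann–Hilton argument: composition is a subgroup, so the unit laws (a, i) ↦ a and (i, b) ↦
  -- b may be multiplied with (i, i) ↦ i inverted between them. Doing this with `i` on the other
  -- sides gives (b, a) the same composite.
  have hc : c = a * i⁻¹ * b := by
    have h6 : ((a * i⁻¹ * i, i * i⁻¹ * b), a * i⁻¹ * b) ∈ M :=
      M.mul_mem (M.mul_mem h2 (M.inv_mem h5)) h3
    rw [inv_mul_cancel_right, mul_inv_cancel, _root_.one_mul] at h6
    exact G.unique h6 hab
  have h6 : ((i * i⁻¹ * b, a * i⁻¹ * i), a * i⁻¹ * b) ∈ M :=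
    M.mul_mem (M.mul_mem h1 (M.inv_mem h5)) h4
  rw [inv_mul_cancel_right, mul_inv_cancel, _root_.one_mul] at h6
  exact hc ▸ h6

/-- The broadcasting map used in `Rel` is a union of two relations and need not be a subgroup. Here
`comul` itself works, because commutativity makes it closed under inverses. -/
theorem isBroadcastable_of_l_eq_r (A : CPStar RelGrp.{u})
    (G : ArrowGroupoid (mulRel A.X.toRelSet) (oneRel A.X.toRelSet)) (h : ∀ x, G.l x = G.r x) :
    IsBroadcastable A := by
  refine ⟨comul A.X, ?_, comul_counit_left A.X, comul_counit_right A.X⟩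
  refine (isCP_iff (Y := A.X ⊗ A.X) rfl mulRel_tensor G (G.prod G) _).2 ?_
  rintro z ⟨x, y⟩ hp
  replace hp : mulRel A.X.toRelSet x y z := hp
  refine ⟨mul_comm_of_l_eq_r G h (G.inv_mul_inv hp), ?_⟩
  change mulRel A.X.toRelSet (G.l x) (G.l y) (G.l z)
  rw [G.l_eq_r hp, ← h x, G.l_eq_l hp]
  have h1 : mulRel A.X.toRelSet (G.l (G.l x)) (G.l x) (G.l x) := G.l_mul (G.l x)
  rwa [G.l_eq (G.e_l x)] at h1

theorem admitsEntanglement_of_l_ne_r (A : CPStar RelGrp.{u})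
    (G : ArrowGroupoid (mulRel A.X.toRelSet) (oneRel A.X.toRelSet)) {x : A.X}
    (h : G.l x ≠ G.r x) : AdmitsEntanglement A := by
  refine ⟨A, (coev A.X : 𝟙_ RelGrp ⟶ A.X ⊗ A.X), ?_, ?_⟩
  · refine (isCP_iff (Y := A.X ⊗ A.X) mulRel_unit mulRel_tensor .punit (G.prod G) _).2 ?_
    rintro ⟨⟩ ⟨a, b⟩ hab
    obtain rfl : a = b := hab
    exact ⟨rfl, rfl⟩
  · rintro ⟨A', B', ψ, f, g, hA, hB, hψ, hf, hg, hω⟩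
    obtain ⟨GA⟩ := CPStar.nonempty_arrowGroupoid A'
    obtain ⟨GB⟩ := CPStar.nonempty_arrowGroupoid B'
    have hψ := (isCP_iff (Y := A'.X ⊗ B'.X) mulRel_unit mulRel_tensor .punit (GA.prod GB) ψ).1 hψ
    have hf := (isCP_iff rfl rfl GA G f).1 hf
    have hg := (isCP_iff rfl rfl GB G g).1 hg
    exact h (RelSet.R_of_eq_comp_tensorHom G G GA GB (l_eq_r_of_isBroadcastable hB GB)
      (congrArg Hom.toRel hω) (fun p hp => (hψ ⟨⟩ p hp).2) (fun a y hy => (hf a y hy).2) hg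
      (x := x) (y := x) rfl)

/-- The pair groupoid on the underlying set of a group is an internal groupoid in groups. -/
abbrev pairMonObj (H : Type u) [Group H] : MonObj (of (H × H)) where
  one := .mk
    { carrier := {p | p.2.1 = p.2.2}
      mul_mem' := fun {_ _} ha hb => congrArg₂ (· * ·) ha hb
      one_mem' := rfl
      inv_mem' := fun {_} ha => congrArg (·⁻¹) ha }
  mul := .mk
    { carrier := {p | p.1.1.2 = p.1.2.1 ∧ (p.1.1.1, p.1.2.2) = p.2}
      mul_mem' := fun {_ _} ha hb => ⟨congrArg₂ (· * ·) ha.1 hb.1, congrArg₂ (· * ·) ha.2 hb.2⟩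
      one_mem' := ⟨rfl, rfl⟩
      inv_mem' := fun {_} ha => ⟨congrArg (·⁻¹) ha.1, congrArg (·⁻¹) ha.2⟩ }
  one_mul := Hom.toRel_injective (RelSet.monObj (.pair H)).one_mul
  mul_one := Hom.toRel_injective (RelSet.monObj (.pair H)).mul_one
  mul_assoc := Hom.toRel_injective (RelSet.monObj (.pair H)).mul_assoc

/-- The object of `CP*[Rel(Gp)]` given by the pair groupoid on a group. -/
def pairCPStar (H : Type u) [Group H] : CPStar RelGrp.{u} :=
  letI := pairMonObj H
  { X := of (H × H)
    frob :=
      { frobenius := Hom.toRel_injective (RelSet.monObj_frobenius (.pair H))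
        symmetric := Hom.toRel_injective (RelSet.monObj_symmetric (.pair H))
        special := Hom.toRel_injective (RelSet.monObj_special (.pair H)) } }

theorem nonlocal : Nonlocal RelGrp.{u} := by
  refine ⟨⟨pairCPStar (ULift.{u} (Multiplicative (ZMod 2))), fun h => ?_⟩, fun A hA => ?_⟩
  · have := l_eq_r_of_isBroadcastable h (.pair _) (1, ⟨.ofAdd 1⟩)
    exact absurd (congrArg (fun p => p.1.down) this) (by decide)
  · obtain ⟨G⟩ := CPStar.nonempty_arrowGroupoid A
    by_contra h
    refine hA (isBroadcastable_of_l_eq_r A G fun x => ?_)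
    by_contra hx
    exact h (admitsEntanglement_of_l_ne_r A G hx)

end RelGrp

/-! ### Matrices of natural numbers -/

/-- The objects of the category of matrices of natural numbers: finite sets. -/
structure NatMat : Type (u + 1) where
  of ::
  carrier : Type u
  [fintype : Fintype carrier]

namespace NatMat

instance : CoeSort NatMat.{u} (Type u) := ⟨carrier⟩

instance (X : NatMat.{u}) : Fintype X := X.fintype

/-- The morphisms: matrices of natural numbers. -/
@[ext]
structure Hom (X Y : NatMat.{u}) : Type u where
  M : X → Y → ℕ

open scoped Classical in
/-- The Kronecker delta. -/
noncomputable def delta {X : Type*} (x y : X) : ℕ := if x = y then 1 else 0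

@[simp] theorem delta_self {X : Type*} (x : X) : delta x x = 1 := if_pos rfl

theorem delta_of_ne {X : Type*} {x y : X} (h : x ≠ y) : delta x y = 0 := if_neg h

theorem delta_congr {X Y : Type*} {x y : X} {x' y' : Y} (h : x = y ↔ x' = y') :
    delta x y = delta x' y' := by
  by_cases hx : x = y
  · rw [delta, delta, if_pos hx, if_pos (h.1 hx)]
  · rw [delta, delta, if_neg hx, if_neg (mt h.2 hx)]

theorem delta_comm {X : Type*} (x y : X) : delta x y = delta y x := delta_congr eq_comm

theorem delta_prod {X Y : Type*} (p q : X × Y) :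
    delta p q = delta p.1 q.1 * delta p.2 q.2 := by
  by_cases h : p.1 = q.1
  · rw [h, delta_self, _root_.one_mul]
    exact delta_congr (Prod.ext_iff.trans (and_iff_right h))
  · rw [delta_of_ne h, delta_of_ne (ne_of_apply_ne _ h), zero_mul]

theorem delta_equiv {X Y : Type*} (e : X ≃ Y) (x : X) (y : Y) :
    delta (e x) y = delta x (e.symm y) := delta_congr (Equiv.eq_symm_apply _).symm

@[simp] theorem sum_delta_mul {X : Type*} [Fintype X] (x : X) (f : X → ℕ) :
    ∑ y, delta x y * f y = f x := by
  rw [Finset.sum_eq_single x (fun y _ h => by rw [delta_of_ne h.symm, zero_mul]) (by simp),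
    delta_self, _root_.one_mul]

@[simp] theorem sum_delta_mul' {X : Type*} [Fintype X] (x : X) (f : X → ℕ) :
    ∑ y, delta y x * f y = f x := by
  simp only [delta_comm _ x, sum_delta_mul]

@[simp] theorem sum_mul_delta {X : Type*} [Fintype X] (x : X) (f : X → ℕ) :
    ∑ y, f y * delta x y = f x := by
  simp only [_root_.mul_comm (f _), sum_delta_mul]

@[simp] theorem sum_mul_delta' {X : Type*} [Fintype X] (x : X) (f : X → ℕ) :
    ∑ y, f y * delta y x = f x := by
  simp only [delta_comm _ x, sum_mul_delta]

@[simp] theorem sum_delta {X : Type*} [Fintype X] (x : X) : ∑ y, delta y x = 1 := by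
  simpa using sum_delta_mul' x (fun _ => 1)

/-- Matrix multiplication. -/
noncomputable instance : LargeCategory NatMat.{u} where
  Hom := Hom
  id _ := ⟨delta⟩
  comp f g := ⟨fun x z => ∑ y, f.M x y * g.M y z⟩
  id_comp f := by ext x y; simp
  comp_id f := by ext x y; simp
  assoc f g h := by
    ext x w
    simp only [Finset.sum_mul, Finset.mul_sum, _root_.mul_assoc]
    exact Finset.sum_comm

@[ext] theorem hom_ext {X Y : NatMat.{u}} {f g : X ⟶ Y} (h : ∀ x y, f.M x y = g.M x y) : f = g :=
  Hom.ext (funext fun x => funext fun y => h x y)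

@[simp] theorem M_id {X : NatMat.{u}} (x y : X) : Hom.M (𝟙 X) x y = delta x y := rfl

theorem M_comp {X Y Z : NatMat.{u}} (f : X ⟶ Y) (g : Y ⟶ Z) (x : X) (z : Z) :
    Hom.M (f ≫ g) x z = ∑ y, f.M x y * g.M y z := rfl

/-- The matrix of a bijection. -/
noncomputable def graph {X Y : NatMat.{u}} (e : X ≃ Y) : X ⟶ Y := Hom.mk fun x y => delta (e x) y

@[simp] theorem M_graph {X Y : NatMat.{u}} (e : X ≃ Y) (x : X) (y : Y) :
    Hom.M (graph e) x y = delta (e x) y := rfl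

@[simp] theorem M_graph_comp {X Y Z : NatMat.{u}} (e : X ≃ Y) (f : Y ⟶ Z) (x : X) (z : Z) :
    Hom.M (graph e ≫ f) x z = f.M (e x) z := by
  simp [M_comp]

@[simp] theorem M_comp_graph {X Y Z : NatMat.{u}} (e : Y ≃ Z) (f : X ⟶ Y) (x : X) (z : Z) :
    Hom.M (f ≫ graph e) x z = f.M x (e.symm z) := by
  simp [M_comp, delta_equiv]

/-- All coherence isomorphisms are graphs of bijections, so the pentagon, triangle and hexagons
reduce to identities between bijections that hold by `rfl`. -/
theorem graph_comp_graph {X Y Z : NatMat.{u}} (e : X ≃ Y) (e' : Y ≃ Z) :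
    graph e ≫ graph e' = graph (e.trans e') := by
  ext x z
  rw [M_comp_graph, M_graph, M_graph, Equiv.trans_apply, delta_equiv e']

/-- The isomorphism given by a bijection. -/
noncomputable def isoMk {X Y : NatMat.{u}} (e : X ≃ Y) : X ≅ Y where
  hom := graph e
  inv := graph e.symm
  hom_inv_id := by ext; simp [delta_equiv]
  inv_hom_id := by ext; simp [delta_equiv]

/-- The Kronecker product. -/
noncomputable instance : MonoidalCategoryStruct NatMat.{u} where
  tensorObj X Y := of (X × Y)
  whiskerLeft _ _ _ f := Hom.mk fun p q => delta p.1 q.1 * f.M p.2 q.2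
  whiskerRight f _ := Hom.mk fun p q => f.M p.1 q.1 * delta p.2 q.2
  tensorHom f g := Hom.mk fun p q => f.M p.1 q.1 * g.M p.2 q.2
  tensorUnit := of PUnit
  associator X Y Z := isoMk (Equiv.prodAssoc X Y Z)
  leftUnitor X := isoMk (Equiv.punitProd X)
  rightUnitor X := isoMk (Equiv.prodPUnit X)

section

variable {X X' Y Y' Z : NatMat.{u}}

@[simp] theorem M_whiskerLeft (f : Y ⟶ Y') (p : (X ⊗ Y : NatMat)) (q : (X ⊗ Y' : NatMat)) :
    Hom.M (X ◁ f) p q = delta p.1 q.1 * f.M p.2 q.2 := rfl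

@[simp] theorem M_whiskerRight (f : X ⟶ X') (p : (X ⊗ Y : NatMat)) (q : (X' ⊗ Y : NatMat)) :
    Hom.M (f ▷ Y) p q = f.M p.1 q.1 * delta p.2 q.2 := rfl

@[simp] theorem M_tensorHom (f : X ⟶ X') (g : Y ⟶ Y') (p : (X ⊗ Y : NatMat))
    (q : (X' ⊗ Y' : NatMat)) : Hom.M (f ⊗ₘ g) p q = f.M p.1 q.1 * g.M p.2 q.2 := rfl

theorem associator_hom : (α_ X Y Z).hom =
    graph (X := (X ⊗ Y) ⊗ Z) (Y := X ⊗ (Y ⊗ Z)) (Equiv.prodAssoc X Y Z) := rfl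

theorem associator_inv : (α_ X Y Z).inv =
    graph (X := X ⊗ (Y ⊗ Z)) (Y := (X ⊗ Y) ⊗ Z) (Equiv.prodAssoc X Y Z).symm := rfl

theorem leftUnitor_hom : (λ_ X).hom = graph (X := 𝟙_ NatMat ⊗ X) (Equiv.punitProd X) := rfl

theorem leftUnitor_inv : (λ_ X).inv = graph (Y := 𝟙_ NatMat ⊗ X) (Equiv.punitProd X).symm := rfl

theorem rightUnitor_hom : (ρ_ X).hom = graph (X := X ⊗ 𝟙_ NatMat) (Equiv.prodPUnit X) := rfl

theorem rightUnitor_inv : (ρ_ X).inv = graph (Y := X ⊗ 𝟙_ NatMat) (Equiv.prodPUnit X).symm := rfl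

theorem whiskerLeft_graph (e : Y ≃ Y') : X ◁ graph e =
    graph (X := X ⊗ Y) (Y := X ⊗ Y') (Equiv.prodCongr (Equiv.refl X) e) := by
  ext p q
  exact (delta_prod (p.1, e p.2) q).symm

theorem graph_whiskerRight (e : Y ≃ Y') : graph e ▷ X =
    graph (X := Y ⊗ X) (Y := Y' ⊗ X) (Equiv.prodCongr e (Equiv.refl X)) := by
  ext p q
  exact (delta_prod (e p.1, p.2) q).symm

theorem sum_tensor (F : (X ⊗ Y : NatMat) → ℕ) : ∑ p, F p = ∑ x : X, ∑ y : Y, F (x, y) :=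
  Fintype.sum_prod_type _

end

noncomputable instance : MonoidalCategory NatMat.{u} where
  tensorHom_def f g := by
    ext p q
    simp only [M_comp, sum_tensor, M_whiskerLeft, M_whiskerRight, M_tensorHom,
      _root_.mul_mul_mul_comm (f.M _ _), ← Finset.sum_mul_sum, sum_mul_delta', sum_delta_mul]
  id_tensorHom_id X Y := by
    ext p q
    exact (delta_prod p q).symm
  tensorHom_comp_tensorHom f f' g g' := by
    ext p q
    simp only [M_comp, sum_tensor, M_tensorHom, Finset.sum_mul_sum]
    simp only [_root_.mul_mul_mul_comm]
  whiskerLeft_id X Y := by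
    ext p q
    exact (delta_prod p q).symm
  id_whiskerRight X Y := by
    ext p q
    exact (delta_prod p q).symm
  associator_naturality f g h := by
    ext p q
    rw [associator_hom, associator_hom, M_comp_graph, M_graph_comp]
    exact _root_.mul_assoc _ _ _
  leftUnitor_naturality f := by
    ext p q
    rw [leftUnitor_hom, leftUnitor_hom, M_comp_graph, M_graph_comp]
    exact (congrArg (· * _) (delta_self _)).trans (_root_.one_mul _)
  rightUnitor_naturality f := by
    ext p q
    rw [rightUnitor_hom, rightUnitor_hom, M_comp_graph, M_graph_comp]
    exact (congrArg (_ * ·) (delta_self _)).trans (_root_.mul_one _)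
  pentagon W X Y Z := by
    simp only [associator_hom, whiskerLeft_graph, graph_whiskerRight, graph_comp_graph]
    rfl
  triangle X Y := by
    simp only [associator_hom, leftUnitor_hom, rightUnitor_hom, whiskerLeft_graph,
      graph_whiskerRight, graph_comp_graph]
    rfl

noncomputable instance : SymmetricCategory NatMat.{u} where
  braiding X Y := isoMk (X := X ⊗ Y) (Y := Y ⊗ X) (Equiv.prodComm X Y)
  braiding_naturality_right X _ _ f := by
    ext p q
    refine (M_comp_graph _ _ _ _).trans (Eq.trans ?_ (M_graph_comp _ _ _ _).symm)
    exact _root_.mul_comm _ _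
  braiding_naturality_left f Z := by
    ext p q
    refine (M_comp_graph _ _ _ _).trans (Eq.trans ?_ (M_graph_comp _ _ _ _).symm)
    exact _root_.mul_comm _ _
  hexagon_forward X Y Z := by
    simp only [isoMk, associator_hom, whiskerLeft_graph, graph_whiskerRight, graph_comp_graph]
    rfl
  hexagon_reverse X Y Z := by
    simp only [isoMk, associator_inv, whiskerLeft_graph, graph_whiskerRight, graph_comp_graph]
    rfl
  symmetry X Y := (isoMk (X := X ⊗ Y) (Y := Y ⊗ X) (Equiv.prodComm X Y)).hom_inv_id

theorem braiding_hom {X Y : NatMat.{u}} : (β_ X Y).hom =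
    graph (X := X ⊗ Y) (Y := Y ⊗ X) (Equiv.prodComm X Y) := rfl

/-- The transpose of a matrix. -/
def transpose {X Y : NatMat.{u}} (f : X ⟶ Y) : Y ⟶ X := Hom.mk fun y x => f.M x y

theorem transpose_graph {X Y : NatMat.{u}} (e : X ≃ Y) : transpose (graph e) = graph e.symm := by
  ext y x
  exact (delta_equiv e x y).trans (delta_comm _ _)

/-- The dagger is the transpose; every finite set is its own dual, with the diagonal as cup
and cap. -/
noncomputable instance : CompactDagger NatMat.{u} where
  dag f := transpose f
  dag_dag _ := rfl
  dag_id X := by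
    ext x y
    exact delta_comm _ _
  dag_comp f g := by
    ext x y
    exact Finset.sum_congr rfl fun _ _ => _root_.mul_comm _ _
  dag_tensor _ _ := rfl
  dag_associator _ _ _ := transpose_graph _
  dag_leftUnitor _ := transpose_graph _
  dag_rightUnitor _ := transpose_graph _
  dag_braiding _ _ := transpose_graph _
  dual X := X
  coev _ := Hom.mk fun _ p => delta p.1 p.2
  ev _ := Hom.mk fun p _ => delta p.1 p.2
  snake X := by
    ext x y
    rw [rightUnitor_inv, M_graph_comp, M_comp, sum_tensor]
    simp only [associator_inv, leftUnitor_hom, M_graph_comp, M_comp_graph, sum_tensor]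
    change ∑ a, ∑ b, ∑ c, delta x a * delta b c * (delta a b * delta c y) = delta x y
    simp only [_root_.mul_assoc, ← Finset.mul_sum, sum_delta_mul]
  snake_dual X := by
    ext x y
    rw [leftUnitor_inv, M_graph_comp, M_comp, sum_tensor]
    simp only [associator_hom, rightUnitor_hom, M_graph_comp, M_comp_graph, sum_tensor]
    change ∑ a, ∑ b, ∑ c, delta a b * delta x c * (delta a y * delta b c) = delta x y
    simp only [_root_.mul_assoc, ← Finset.mul_sum, sum_delta_mul]
    exact (sum_delta_mul' y _).trans (delta_comm y x)
  dag_ev X := by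
    ext p q
    rw [braiding_hom, M_comp_graph]
    exact delta_comm _ _

end NatMat

/-! ### Entries of actions and doublings -/

namespace NatMat
open CompactDagger

variable {X Y : NatMat.{u}}

theorem M_congr {f g : X ⟶ Y} (h : f = g) (x : X) (y : Y) : f.M x y = g.M x y := by rw [h]

theorem M_action [MonObj X] (x : X) (p : (dual X ⊗ X : NatMat)) :
    Hom.M (action X) x p = Hom.M (μ : X ⊗ X ⟶ X) (p.1, x) p.2 := by
  rw [action, leftUnitor_inv, M_graph_comp, M_comp, sum_tensor]
  simp only [associator_hom, M_graph_comp, sum_tensor]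
  change ∑ a, ∑ b, ∑ c, delta a b * delta x c * (delta a p.1 * Hom.M (μ : X ⊗ X ⟶ X) (b, c) p.2) = _
  simp only [_root_.mul_assoc, ← Finset.mul_sum, sum_delta_mul, sum_delta_mul']

theorem M_bentConj {Z : NatMat.{u}} (g : X ⟶ Z ⊗ Y) (p : (dual X ⊗ Z : NatMat)) (y : Y) :
    Hom.M (bentConj g) p y = g.M p.1 (p.2, y) := by
  obtain ⟨x, z⟩ := p
  rw [bentConj, rightUnitor_inv, M_graph_comp, M_comp, sum_tensor]
  simp only [associator_hom, associator_inv, graph_whiskerRight, leftUnitor_hom, M_graph_comp,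
    sum_tensor]
  have h (a : X) (z : Z) (b c : Y) : Hom.M ((dual X ◁ dag g) ▷ dual Y ≫ dag (coev X) ▷ dual Y ≫
      graph (X := 𝟙_ NatMat ⊗ dual Y) (Equiv.punitProd (dual Y).carrier)) ((a, (z, b)), c) y =
      g.M a (z, b) * delta c y := by
    rw [M_comp, sum_tensor]
    simp only [M_comp_graph, sum_tensor]
    change ∑ a', ∑ a'', ∑ c', delta a a' * g.M a'' (z, b) * delta c c' *
      (delta a' a'' * delta c' y) = _
    simp only [_root_.mul_assoc, ← Finset.mul_sum, sum_delta_mul]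
    simp only [_root_.mul_left_comm (g.M _ _), sum_delta_mul]
  change ∑ x', ∑ z', ∑ y₁, ∑ y₂, delta (x, z) (x', z') * delta y₁ y₂ *
    Hom.M ((dual X ◁ dag g) ▷ dual Y ≫ dag (coev X) ▷ dual Y ≫
      graph (X := 𝟙_ NatMat ⊗ dual Y) (Equiv.punitProd (dual Y).carrier))
      ((x', (z', y₁)), y₂) y = _
  simp only [h, _root_.mul_assoc, ← Finset.mul_sum, sum_delta_mul, sum_mul_delta', delta_prod]

theorem M_doubling {Z : NatMat.{u}} (g : X ⟶ Z ⊗ Y) (p : (dual X ⊗ X : NatMat))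
    (q : (dual Y ⊗ Y : NatMat)) :
    Hom.M (doubling g) p q = ∑ z, g.M p.1 (z, q.1) * g.M p.2 (z, q.2) := by
  rw [doubling, M_comp, sum_tensor]
  simp only [associator_inv, M_graph_comp, sum_tensor]
  change ∑ a, ∑ z, ∑ c, delta p.1 a * g.M p.2 (z, c) *
    (Hom.M (bentConj g) (a, z) q.1 * delta c q.2) = _
  simp only [_root_.mul_assoc, ← Finset.mul_sum, sum_delta_mul]
  simp only [← _root_.mul_assoc, sum_mul_delta']
  refine Finset.sum_congr rfl fun z _ => ?_
  rw [M_bentConj]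
  exact _root_.mul_comm _ _

/-! ### Special monoids are discrete -/

/-- The multiplication of a monoid matches equal elements. -/
def IsDiscrete (X : NatMat.{u}) [MonObj X] : Prop :=
  ∀ x y z : X, Hom.M (μ : X ⊗ X ⟶ X) (x, y) z = delta x z * delta y z

theorem sum_one_mul [MonObj X] (x z : X) :
    ∑ i, Hom.M (η : 𝟙_ NatMat ⟶ X) ⟨⟩ i * Hom.M (μ : X ⊗ X ⟶ X) (i, x) z = delta x z := by
  refine Eq.trans ?_ (M_congr (MonObj.one_mul X) (⟨⟩, x) z)
  rw [M_comp, sum_tensor]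
  change _ = ∑ i, ∑ y, Hom.M (η : 𝟙_ NatMat ⟶ X) ⟨⟩ i * delta x y * Hom.M (μ : X ⊗ X ⟶ X) (i, y) z
  simp only [_root_.mul_assoc, ← Finset.mul_sum, sum_delta_mul]

theorem sum_mul_one [MonObj X] (x z : X) :
    ∑ i, Hom.M (η : 𝟙_ NatMat ⟶ X) ⟨⟩ i * Hom.M (μ : X ⊗ X ⟶ X) (x, i) z = delta x z := by
  refine Eq.trans ?_ (M_congr (MonObj.mul_one X) (x, ⟨⟩) z)
  rw [M_comp, sum_tensor]
  change _ = ∑ y, ∑ i, delta x y * Hom.M (η : 𝟙_ NatMat ⟶ X) ⟨⟩ i * Hom.M (μ : X ⊗ X ⟶ X) (y, i) z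
  simp only [_root_.mul_assoc, ← Finset.mul_sum, sum_delta_mul]

theorem eq_of_sum_le_one {α : Type*} [Fintype α] {F : α → ℕ} (h : ∑ a, F a ≤ 1) {a b : α}
    (ha : F a ≠ 0) (hb : F b ≠ 0) : a = b := by
  classical
  by_contra hab
  have h1 : ∑ c ∈ {a, b}, F c ≤ ∑ c, F c := Finset.sum_le_sum_of_subset (Finset.subset_univ _)
  rw [Finset.sum_pair hab] at h1
  lia

theorem eq_delta_of_sum_le_one {α : Type*} [Fintype α] {F : α → ℕ} (h : ∑ a, F a ≤ 1) {a : α}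
    (ha : F a ≠ 0) (b : α) : F b = delta b a := by
  by_cases hb : b = a
  · subst hb
    have : F b ≤ ∑ c, F c := Finset.single_le_sum (fun _ _ => Nat.zero_le _) (Finset.mem_univ b)
    rw [delta_self]
    lia
  · rw [delta_of_ne hb]
    by_contra hb'
    exact hb (eq_of_sum_le_one h hb' ha)

/-- The diagonal entry of speciality at `z` says that the squares of the entries of `μ` into `z` sum
to 1, so at most one pair has a nonzero entry, and that entry is 1. The two unit laws give nonzero
entries at some (i, z) and (z, j), so the pair is (z, z). -/
theorem isDiscrete_of_special [MonObj X] (hs : comul X ≫ μ = 𝟙 X) : IsDiscrete X := by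
  intro x y z
  have h1 : ∑ p : X × X, (Hom.M (μ : X ⊗ X ⟶ X) p z) ^ 2 ≤ 1 := by
    simp only [sq]
    exact ((M_congr hs z z).trans (delta_self z)).le
  have h2 : ∑ p : X × X, Hom.M (μ : X ⊗ X ⟶ X) p z ≤ 1 :=
    (Finset.sum_le_sum fun p _ => Nat.le_self_pow two_ne_zero _).trans h1
  obtain ⟨i, -, hi⟩ := Finset.exists_ne_zero_of_sum_ne_zero
    ((sum_one_mul z z).trans (delta_self z) ▸ one_ne_zero)
  obtain ⟨j, -, hj⟩ := Finset.exists_ne_zero_of_sum_ne_zero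
    ((sum_mul_one z z).trans (delta_self z) ▸ one_ne_zero)
  have hi := right_ne_zero_of_mul hi
  have hij : (i, z) = (z, j) := eq_of_sum_le_one h2 hi (right_ne_zero_of_mul hj)
  obtain rfl : i = z := congrArg Prod.fst hij
  exact (eq_delta_of_sum_le_one h2 hi (x, y)).trans (delta_prod _ _)

theorem tensorμ_eq_graph : tensorμ X Y X Y = graph (X := (X ⊗ Y) ⊗ (X ⊗ Y))
    (Y := (X ⊗ X) ⊗ (Y ⊗ Y)) (Equiv.prodProdProdComm X Y X Y) := by
  simp only [tensorμ, associator_hom, associator_inv, braiding_hom, whiskerLeft_graph,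
    graph_whiskerRight, graph_comp_graph]
  rfl

theorem IsDiscrete.tensor [MonObj X] [MonObj Y] (hX : IsDiscrete X) (hY : IsDiscrete Y) :
    IsDiscrete (X ⊗ Y) := by
  intro p q r
  rw [MonObj.tensorObj.mul_def, tensorμ_eq_graph, M_graph_comp]
  refine (congrArg₂ (· * ·) (hX p.1 q.1 r.1) (hY p.2 q.2 r.2)).trans ?_
  rw [delta_prod p r, delta_prod q r, _root_.mul_mul_mul_comm]

theorem IsDiscrete.one_eq [MonObj X] (hX : IsDiscrete X) (x : X) :
    Hom.M (η : 𝟙_ NatMat ⟶ X) ⟨⟩ x = 1 := by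
  have h := sum_one_mul x x
  simpa only [hX _ _ _, delta_self, _root_.mul_one, sum_mul_delta'] using h

/-- Every matrix between discrete monoids is completely positive. -/
theorem isCP_of_isDiscrete [MonObj X] [MonObj Y] (hX : IsDiscrete X) (hY : IsDiscrete Y)
    (f : X ⟶ Y) : IsCP f := by
  -- The ancilla has as many points over (x, y) as the entry of `f`. The doubling counts the points
  -- lying over both (a, c) and (b, d).
  let Z : NatMat.{u} := of (Σ p : X × Y, Fin (f.M p.1 p.2))
  refine ⟨Z, .mk fun a q => delta q.1.1 (a, q.2), ?_⟩
  ext ⟨a, b⟩ ⟨c, d⟩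
  rw [M_doubling, M_comp]
  have h1 (x : X) : Hom.M (coaction X) (a, b) x = delta a b * delta x b :=
    (M_action x (a, b)).trans (hX _ _ _)
  have h2 (y : Y) : Hom.M (action Y) y (c, d) = delta c d * delta y d :=
    (M_action y (c, d)).trans (hY _ _ _)
  have h3 (x : X) : Hom.M (f ≫ action Y) x (c, d) = delta c d * f.M x d := by
    simp only [M_comp, h2, _root_.mul_left_comm (f.M _ _), ← Finset.mul_sum, sum_mul_delta']
  simp only [h1, h3, _root_.mul_assoc, ← Finset.mul_sum, sum_delta_mul']
  have h4 : ∑ z : (p : X × Y) × Fin (f.M p.1 p.2), delta z.1 (a, c) * delta z.1 (b, d) =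
      f.M a c * delta (a, c) (b, d) := by
    simp only [Fintype.sum_sigma, Finset.sum_const, Finset.card_univ, Fintype.card_fin,
      smul_eq_mul, _root_.mul_left_comm (f.M _ _), sum_delta_mul']
  refine Eq.trans ?_ h4.symm
  rw [delta_prod]
  by_cases hab : a = b
  · by_cases hcd : c = d
    · subst hab hcd
      simp
    · simp [delta_of_ne hcd]
  · simp [delta_of_ne hab]

theorem CPStar.isDiscrete (A : CPStar NatMat.{u}) : IsDiscrete A.X :=
  isDiscrete_of_special A.frob.special

theorem isBroadcastable (A : CPStar NatMat.{u}) : IsBroadcastable A :=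
  ⟨comul A.X, isCP_of_isDiscrete (CPStar.isDiscrete A) (.tensor (CPStar.isDiscrete A)
    (CPStar.isDiscrete A)) _, comul_counit_left A.X, comul_counit_right A.X⟩

/-- All objects being broadcastable, each state factors through itself along identities. -/
theorem not_admitsEntanglement (A : CPStar NatMat.{u}) : ¬ AdmitsEntanglement A := by
  rintro ⟨B, ω, hω, h⟩
  refine h ⟨A, B, ω, 𝟙 _, 𝟙 _, isBroadcastable A, isBroadcastable B, hω,
    isCP_of_isDiscrete (CPStar.isDiscrete A) (CPStar.isDiscrete A) _,
    isCP_of_isDiscrete (CPStar.isDiscrete B) (CPStar.isDiscrete B) _, ?_⟩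
  rw [id_tensorHom_id, Category.comp_id]

/-! ### Bit commitment -/

/-- If the row of `x` vanished, `f` could not distinguish the zero matrix from the one concentrated
at `x`. The point `a` ensures that these two differ. -/
theorem exists_ne_zero_of_isCPMono {A : CPStar NatMat.{u}} [MonObj X] [MonObj Y]
    (hX : IsDiscrete X) {f : X ⟶ Y} (hf : IsCPMono f) (a : A.X) (x : X) : ∃ y, f.M x y ≠ 0 := by
  by_contra! h
  have h1 := hf A (.mk fun _ x' => delta x x') (.mk fun _ _ => 0)
    (isCP_of_isDiscrete (CPStar.isDiscrete A) hX _)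
    (isCP_of_isDiscrete (CPStar.isDiscrete A) hX _) (by ext; simp [M_comp, h])
  have h2 : delta x x = 0 := M_congr h1 a x
  simp at h2

/-- Entrywise, copyability reads s(x)δ(x,y) = s(x)s(y), so `s` is zero or a basis vector. -/
theorem sum_le_one_of_isCopyable [MonObj X] (hX : IsDiscrete X) {s : 𝟙_ NatMat.{u} ⟶ X}
    (hs : IsCopyable X s) : ∑ x, s.M ⟨⟩ x ≤ 1 := by
  have key (x y : X) : s.M ⟨⟩ x * delta x y = s.M ⟨⟩ x * s.M ⟨⟩ y := by
    have h := M_congr hs ⟨⟩ (x, y)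
    rw [leftUnitor_inv, M_graph_comp, M_comp] at h
    refine Eq.trans ?_ h
    refine Eq.trans ?_ (Finset.sum_congr rfl fun z _ => congrArg (_ * ·) (hX x y z).symm)
    simp only [_root_.mul_left_comm (s.M _ _), sum_delta_mul, delta_comm y x]
  by_cases h : ∃ x, s.M ⟨⟩ x ≠ 0
  · obtain ⟨x, hx⟩ := h
    have h1 (y : X) : s.M ⟨⟩ y = delta x y * 1 := by
      rw [_root_.mul_one]
      exact (Nat.eq_of_mul_eq_mul_left (Nat.pos_of_ne_zero hx) (key x y)).symm
    simp only [h1, sum_delta_mul, le_refl]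
  · push Not at h
    simp [h]

/-- Over ℕ, a matrix without zero rows cannot decrease the total weight. -/
theorem sum_le_one_of_comp {f : X ⟶ Y} (hf : ∀ x, ∃ y, f.M x y ≠ 0) {s : 𝟙_ NatMat.{u} ⟶ X}
    (hs : ∑ y, Hom.M (s ≫ f) ⟨⟩ y ≤ 1) : ∑ x, s.M ⟨⟩ x ≤ 1 := by
  refine le_trans ?_ hs
  simp only [M_comp]
  rw [Finset.sum_comm]
  refine Finset.sum_le_sum fun x _ => ?_
  rw [← Finset.mul_sum]
  refine Nat.le_mul_of_pos_right _ ?_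
  obtain ⟨y, hy⟩ := hf x
  exact Finset.sum_pos' (fun _ _ => Nat.zero_le _) ⟨y, Finset.mem_univ y, Nat.pos_of_ne_zero hy⟩

theorem M_comp_counit_left [MonObj X] (hX : IsDiscrete X) (s : 𝟙_ NatMat.{u} ⟶ X ⊗ Y) (y : Y) :
    Hom.M (s ≫ counit X ▷ Y) ⟨⟩ (⟨⟩, y) = ∑ x, s.M ⟨⟩ (x, y) := by
  rw [M_comp, sum_tensor]
  change ∑ x, ∑ y', s.M ⟨⟩ (x, y') * (Hom.M (η : 𝟙_ NatMat ⟶ X) ⟨⟩ x * delta y' y) = _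
  simp only [hX.one_eq, _root_.one_mul, sum_mul_delta']

theorem not_supportsBitCommitment : ¬ SupportsBitCommitment NatMat.{u} := by
  rintro ⟨P, ⟨-, hT⟩, hc, hb⟩
  have hA := CPStar.isDiscrete P.A
  have hB := CPStar.isDiscrete P.B
  have hsum : ∑ p, P.T.M ⟨⟩ p ≤ 1 := by
    refine sum_le_one_of_comp (f := P.unveil) (fun p =>
      exists_ne_zero_of_isCPMono (A := P.A) (hA.tensor hB) P.mono_unveil p.1 p) ?_
    rw [hT]
    let := P.cl
    exact sum_le_one_of_isCopyable (isDiscrete_of_special P.isClassical.special) P.copyable_That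
  have hmarg (b : P.B.X) : ∑ a, P.H.M ⟨⟩ (a, b) = ∑ a, P.T.M ⟨⟩ (a, b) := by
    rw [← M_comp_counit_left hA, ← M_comp_counit_left hA, hc]
  -- The cheating operation discards its input and prepares the first marginal of `T`.
  refine hb (.mk fun _ a => ∑ b, P.T.M ⟨⟩ (a, b)) (isCP_of_isDiscrete hA hA _) ?_
  ext ⟨⟩ ⟨a, b⟩
  -- A state of total weight at most 1 is zero or a basis pair, hence the product of its marginals.
  have h1 : (∑ a, P.T.M ⟨⟩ (a, b)) * ∑ b, P.T.M ⟨⟩ (a, b) = P.T.M ⟨⟩ (a, b) := by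
    by_cases h : ∃ p, P.T.M ⟨⟩ p ≠ 0
    · obtain ⟨⟨a', b'⟩, hp⟩ := h
      have h1 (x : P.A.X) (y : P.B.X) : P.T.M ⟨⟩ (x, y) = delta x a' * delta y b' :=
        (eq_delta_of_sum_le_one hsum hp (x, y)).trans (delta_prod (x, y) (a', b'))
      simp only [h1, sum_delta_mul', ← Finset.mul_sum]
      rw [sum_delta, _root_.mul_one, _root_.mul_comm]
    · push Not at h
      simp [h]
  rw [← h1, ← hmarg, M_comp, sum_tensor]
  change ∑ x, ∑ y, P.H.M ⟨⟩ (x, y) * ((∑ b, P.T.M ⟨⟩ (a, b)) * delta y b) = _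
  rw [Finset.sum_mul]
  refine Finset.sum_congr rfl fun x _ => ?_
  simp only [_root_.mul_left_comm (P.H.M _ _), ← Finset.mul_sum, sum_mul_delta']
  exact _root_.mul_comm _ _

theorem exists_state_ne : ∃ (X : NatMat.{u}) (s t : 𝟙_ NatMat.{u} ⟶ X), s ≠ t :=
  ⟨of PUnit, .mk fun _ _ => 0, .mk fun _ _ => 1, fun h =>
    absurd (M_congr h ⟨⟩ ⟨⟩) zero_ne_one⟩

end NatMat

/-! ### The separation theorem -/

theorem mainTheorem3 :
    -- "no bit commitment" does not imply "nonlocality"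
    (¬ ∀ (C : Type (u + 1)) [Category.{u} C] [MonoidalCategory C] [SymmetricCategory C]
        [CompactDagger C],
      ¬ CompactDagger.SupportsBitCommitment C → CompactDagger.Nonlocal C) ∧
    -- "nonlocality" does not imply "no bit commitment"
    (¬ ∀ (C : Type (u + 1)) [Category.{u} C] [MonoidalCategory C] [SymmetricCategory C]
        [CompactDagger C],
      CompactDagger.Nonlocal C → ¬ CompactDagger.SupportsBitCommitment C) ∧
    -- `Rel`
    (CompactDagger.Nonlocal RelSet.{u} ∧ CompactDagger.SupportsBitCommitment RelSet.{u}) ∧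
    -- `Rel(Gp)`
    ((∀ (X : RelGrp.{u}) [MonObj X], CompactDagger.IsClassicalStructure X →
        ∀ s t : 𝟙_ RelGrp.{u} ⟶ X,
          CompactDagger.IsCopyable X s → CompactDagger.IsCopyable X t → s = t) ∧
      ¬ CompactDagger.SupportsBitCommitment RelGrp.{u} ∧
      CompactDagger.Nonlocal RelGrp.{u}) ∧
    -- a category with distinct states, without bit commitment and without any entanglement
    (∃ (C : Type (u + 1)) (_ : Category.{u} C) (_ : MonoidalCategory C) (_ : SymmetricCategory C)
        (_ : CompactDagger C),
      (∃ (X : C) (s t : 𝟙_ C ⟶ X), s ≠ t) ∧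
      ¬ CompactDagger.SupportsBitCommitment C ∧
      ∀ A : CompactDagger.CPStar C, ¬ CompactDagger.AdmitsEntanglement A) := by
  have key : ¬ CompactDagger.Nonlocal NatMat.{u} := fun ⟨⟨A, hA⟩, h⟩ =>
    NatMat.not_admitsEntanglement A (h A hA)
  exact ⟨fun h => key (h NatMat.{u} NatMat.not_supportsBitCommitment),
    fun h => h RelSet.{u} RelSet.nonlocal RelSet.supportsBitCommitment,
    ⟨RelSet.nonlocal, RelSet.supportsBitCommitment⟩,
    ⟨fun _ _ hX _ _ hs ht => RelGrp.IsCopyable.eq hX hs ht, RelGrp.not_supportsBitCommitment,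
      RelGrp.nonlocal⟩,
    NatMat.{u}, inferInstance, inferInstance, inferInstance, inferInstance,
    NatMat.exists_state_ne, NatMat.not_supportsBitCommitment, NatMat.not_admitsEntanglement⟩
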